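/- Conventions. A dagger compact category is a symmetric monoidal category $(\mathbf V,\otimes,I,\alpha,\lambda,\rho,\sigma)$ in which every object $A$ comes with a dual $A^*$ and maps $\eta_A\colon I\to A^*\otimes A$ and $\varepsilon_A\colon A\otimes A^*\to I$ satisfying the two snake equations, together with an identity-on-objects involutive contravariant functor $\dagger$ such that $(f\otimes g)^\dagger=f^\dagger\otimes g^\dagger$, the coherence isomorphisms $\alpha,\lambda,\rho,\sigma$ are unitary, and $\sigma_{A,A^*}\circ\varepsilon_A^\dagger=\eta_A$. Write $f^*\colon B^*\to A^*$ for the transpose of $f\colon A\to B$, $f_*=(f^\dagger)^*\colon A^*\to B^*$, and $\varepsilon'_A=\varepsilon_A\circ\sigma_{A^*,A}\colon A^*\otimes A\to I$; coherence isomorphisms, including the canonical $(A\otimes B)^*\cong B^*\otimes A^*$, are suppressed. A normalisable dagger Frobenius algebra in $\mathbf V$ is an object $A$ with maps $\mu\colon A\otimes A\to A$ and $u\colon I\to A$ that are associative and unital and satisfy the Frobenius law $(\mu\otimes 1)(1\otimes\mu^\dagger)=\mu^\dagger\mu=(1\otimes\mu)(\mu^\dagger\otimes 1)$, together with a normaliser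 $z\colon A\to A$ that is central ($\mu(z\otimes1)=z\mu=\mu(1\otimes z)$), positive definite (an isomorphism of the form $h^\dagger h$) and satisfies $\mathrm{Tr}_A(\mu)\circ z^2=u^\dagger$, where $\mathrm{Tr}_A(\mu)\colon A\to I$ is the partial trace of $\mu$ over its second input and output. A map $f\colon A\to B$ of $\mathbf V$ between two such algebras satisfies the CP*-condition if there are an object $X$ and a map $g\colon A\to X\otimes B$ (a Kraus map) with $$(1_{B^*}\otimes\mu_B)\circ(\eta_B\otimes 1_B)\circ f\circ(\varepsilon'_A\otimes 1_A)\circ(1_{A^*}\otimes\mu_A^\dagger)=(1_{B^*}\otimes\varepsilon'_X\otimes 1_B)\circ(g_*\otimes g)\colon A^*\otimes A\to B^*\otimes B .$$ Theorem. Let $\mathbf V$ be a dagger compact category. Then there is a well-defined dagger compact category $\mathrm{CP}^*[\mathbf V]$ whose objects are the normalisable dagger Frobenius algebras in $\mathbf V$, whose morphisms $A\to B$ are exactly the maps $A\to B$ of $\mathbf V$ that satisfy the CP*-condition, and all of whose structure is inherited from $\mathbf V$: composition, identities, the dagger, the tensor product of morphisms, the coherence isomorphisms $\alpha,\lambda,\rho$,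 the symmetry $\sigma$, and the cups $\eta_A$ and caps $\varepsilon_A$ are those of $\mathbf V$. On objects, the tensor product of $(A,\mu_A,u_A,z_A)$ and $(B,\mu_B,u_B,z_B)$ is $A\otimes B$ with multiplication $(\mu_A\otimes\mu_B)\circ(1_A\otimes\sigma_{B,A}\otimes1_B)$, unit $u_A\otimes u_B$ and normaliser $z_A\otimes z_B$; the monoidal unit is $(I,\rho_I,1_I,1_I)$; and the dual of $(A,\mu,u,z)$ is $A^*$ with multiplication $(\mu^\dagger)^*\circ\sigma_{A^*,A^*}\colon A^*\otimes A^*\to A^*$ (so that $A^*$ is the conjugate algebra of $A$), unit $(u^\dagger)^*$ and normaliser $z^*$. -/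

import Mathlib

open CategoryTheory MonoidalCategory

universe v u

namespace DaggerCompact

/-- A dagger on a category: an involutive, identity-on-objects contravariant functor. -/
class DaggerCategory (C : Type u) [Category.{v} C] where
  /-- The dagger of a morphism. -/
  dag : ∀ {X Y : C}, (X ⟶ Y) → (Y ⟶ X)
  dag_id : ∀ X : C, dag (𝟙 X) = 𝟙 X
  dag_comp : ∀ {X Y Z : C} (f : X ⟶ Y) (g : Y ⟶ Z), dag (f ≫ g) = dag g ≫ dag f
  dag_dag : ∀ {X Y : C} (f : X ⟶ Y), dag (dag f) = f

open DaggerCategory (dag)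

section Duals

variable {C : Type u} [Category.{v} C] [MonoidalCategory C] [LeftRigidCategory C]

/-- The chosen dual `A*` of an object `A`. -/
abbrev dualObj (A : C) : C := ᘁA

/-- The cup `η_A : I ⟶ A* ⊗ A`. -/
abbrev cup (A : C) : 𝟙_ C ⟶ dualObj A ⊗ A := η_ (ᘁA) A

/-- The cap `ε_A : A ⊗ A* ⟶ I`. -/
abbrev cap (A : C) : A ⊗ dualObj A ⟶ 𝟙_ C := ε_ (ᘁA) A

/-- The transpose `f^* : B* ⟶ A*` of `f : A ⟶ B`. -/
abbrev transpose {A B : C} (f : A ⟶ B) : dualObj B ⟶ dualObj A := leftAdjointMate f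

/-- The canonical isomorphism `(A ⊗ B)* ≅ B* ⊗ A*`, under which the cup and cap of `A ⊗ B` become
the nested cups and caps of `A` and `B`. -/
def dualTensorIso (A B : C) : dualObj (A ⊗ B) ≅ dualObj B ⊗ dualObj A :=
  @leftDualTensorIso C _ _ A B _ _ (LeftRigidCategory.leftDual (A ⊗ B))

end Duals

/-- A dagger compact category: a symmetric monoidal category with a chosen dual of every object
(with a cup and a cap satisfying the snake equations), and with a dagger for which the monoidal
product is a dagger functor, the coherence isomorphisms are unitary, and the cup is the dagger of
the cap (up to the symmetry, which is needed for the two to have the same type). -/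
class DaggerCompactCategory (C : Type u) [Category.{v} C] [MonoidalCategory C]
    [SymmetricCategory C] extends DaggerCategory C, LeftRigidCategory C where
  dag_tensorHom : ∀ {X₁ Y₁ X₂ Y₂ : C} (f : X₁ ⟶ Y₁) (g : X₂ ⟶ Y₂),
    dag (f ⊗ₘ g) = dag f ⊗ₘ dag g
  dag_associator : ∀ X Y Z : C, dag (α_ X Y Z).hom = (α_ X Y Z).inv
  dag_leftUnitor : ∀ X : C, dag (λ_ X).hom = (λ_ X).inv
  dag_rightUnitor : ∀ X : C, dag (ρ_ X).hom = (ρ_ X).inv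
  dag_braiding : ∀ X Y : C, dag (β_ X Y).hom = (β_ X Y).inv
  dag_cap : ∀ X : C, dag (cap X) ≫ (β_ X (dualObj X)).hom = cup X

section Morphisms

variable {V : Type u} [Category.{v} V]

/-- A positive endomorphism: one of the form `h† ∘ h`. -/
def IsPositive [DaggerCategory V] {A : V} (z : A ⟶ A) : Prop :=
  ∃ (B : V) (h : A ⟶ B), z = h ≫ dag h

/-- A positive definite endomorphism: a positive isomorphism. -/
def IsPositiveDefinite [DaggerCategory V] {A : V} (z : A ⟶ A) : Prop :=
  IsPositive z ∧ IsIso z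

variable [MonoidalCategory V] [SymmetricCategory V] [DaggerCompactCategory V]

/-- The cup `I ⟶ A ⊗ A*`. -/
def cup' (A : V) : 𝟙_ V ⟶ A ⊗ dualObj A := cup A ≫ (β_ (dualObj A) A).hom

/-- The cap `A* ⊗ A ⟶ I`. -/
def cap' (A : V) : dualObj A ⊗ A ⟶ 𝟙_ V := (β_ (dualObj A) A).hom ≫ cap A

/-- The conjugate `f_* = (f†)^* : A* ⟶ B*` of `f : A ⟶ B`. -/
def conj {A B : V} (f : A ⟶ B) : dualObj A ⟶ dualObj B := transpose (dag f)

end Morphisms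

/-- The data of an algebra: an object, a multiplication, a unit, and a candidate normaliser. -/
structure AlgebraData (V : Type u) [Category.{v} V] [MonoidalCategory V] where
  /-- The underlying object. -/
  carrier : V
  /-- The multiplication. -/
  mul : carrier ⊗ carrier ⟶ carrier
  /-- The unit. -/
  one : 𝟙_ V ⟶ carrier
  /-- The normaliser. -/
  normaliser : carrier ⟶ carrier

namespace AlgebraData

variable {V : Type u} [Category.{v} V] [MonoidalCategory V] [SymmetricCategory V]
  [DaggerCompactCategory V]

/-- The comultiplication, the dagger of the multiplication. -/
def comul (A : AlgebraData V) : A.carrier ⟶ A.carrier ⊗ A.carrier := dag A.mul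

/-- The counit, the dagger of the unit. -/
def counit (A : AlgebraData V) : A.carrier ⟶ 𝟙_ V := dag A.one

/-- The partial trace of the multiplication `A ⊗ A ⟶ A` over its second input. -/
def mulTrace (A : AlgebraData V) : A.carrier ⟶ 𝟙_ V :=
  (ρ_ A.carrier).inv ≫ A.carrier ◁ cup' A.carrier ≫
    (α_ A.carrier A.carrier (dualObj A.carrier)).inv ≫ A.mul ▷ (dualObj A.carrier) ≫ cap A.carrier

/-- `(A, mul, one, normaliser)` is a normalisable dagger Frobenius algebra. -/
structure IsNormalisableDaggerFrobenius (A : AlgebraData V) : Prop where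
  mul_assoc : A.mul ▷ A.carrier ≫ A.mul =
    (α_ A.carrier A.carrier A.carrier).hom ≫ A.carrier ◁ A.mul ≫ A.mul
  one_mul : A.one ▷ A.carrier ≫ A.mul = (λ_ A.carrier).hom
  mul_one : A.carrier ◁ A.one ≫ A.mul = (ρ_ A.carrier).hom
  frobenius_left : A.carrier ◁ A.comul ≫ (α_ A.carrier A.carrier A.carrier).inv ≫
    A.mul ▷ A.carrier = A.mul ≫ A.comul
  frobenius_right : A.comul ▷ A.carrier ≫ (α_ A.carrier A.carrier A.carrier).hom ≫
    A.carrier ◁ A.mul = A.mul ≫ A.comul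
  central_left : A.normaliser ▷ A.carrier ≫ A.mul = A.mul ≫ A.normaliser
  central_right : A.carrier ◁ A.normaliser ≫ A.mul = A.mul ≫ A.normaliser
  posDef : IsPositiveDefinite A.normaliser
  normalised : A.normaliser ≫ A.normaliser ≫ A.mulTrace = A.counit

/-- The tensor product of two algebras, with componentwise multiplication. -/
def tensor (A B : AlgebraData V) : AlgebraData V where
  carrier := A.carrier ⊗ B.carrier
  mul := tensorμ A.carrier B.carrier A.carrier B.carrier ≫ (A.mul ⊗ₘ B.mul)
  one := (λ_ (𝟙_ V)).inv ≫ (A.one ⊗ₘ B.one)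
  normaliser := A.normaliser ⊗ₘ B.normaliser

variable (V) in
/-- The algebra on the monoidal unit, with multiplication the coherence isomorphism. -/
def unit : AlgebraData V where
  carrier := 𝟙_ V
  mul := (ρ_ (𝟙_ V)).hom
  one := 𝟙 _
  normaliser := 𝟙 _

/-- The dual algebra on `A*`. Its multiplication is the transpose of the comultiplication,
preceded by the order-preserving identification of `A* ⊗ A*` with `(A ⊗ A)*`; its unit is the
transpose of the counit. -/
def dual (A : AlgebraData V) : AlgebraData V where
  carrier := dualObj A.carrier
  mul := (β_ (dualObj A.carrier) (dualObj A.carrier)).hom ≫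
    (dualTensorIso A.carrier A.carrier).inv ≫ transpose A.comul
  one := cup A.carrier ≫ (dualObj A.carrier) ◁ A.counit ≫ (ρ_ (dualObj A.carrier)).hom
  normaliser := transpose A.normaliser

/-- The action `A ⟶ A* ⊗ A`: the multiplication with its left input bent upwards. -/
def action (A : AlgebraData V) : A.carrier ⟶ dualObj A.carrier ⊗ A.carrier :=
  (λ_ A.carrier).inv ≫ cup A.carrier ▷ A.carrier ≫
    (α_ (dualObj A.carrier) A.carrier A.carrier).hom ≫ (dualObj A.carrier) ◁ A.mul

/-- The coaction `A* ⊗ A ⟶ A`: the comultiplication with its left output bent downwards. -/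
def coaction (A : AlgebraData V) : dualObj A.carrier ⊗ A.carrier ⟶ A.carrier :=
  (dualObj A.carrier) ◁ A.comul ≫ (α_ (dualObj A.carrier) A.carrier A.carrier).inv ≫
    cap' A.carrier ▷ A.carrier ≫ (λ_ A.carrier).hom

end AlgebraData

variable {V : Type u} [Category.{v} V] [MonoidalCategory V] [SymmetricCategory V]
  [DaggerCompactCategory V]

/-- For `g : A ⟶ X ⊗ B`, the map `A* ⊗ A ⟶ B* ⊗ B` obtained from
`g_* ⊗ g : A* ⊗ A ⟶ (B* ⊗ X*) ⊗ (X ⊗ B)` by connecting the two `X`-wires with a cap. -/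
def krausDouble {A B X : V} (g : A ⟶ X ⊗ B) : dualObj A ⊗ A ⟶ dualObj B ⊗ B :=
  ((conj g ≫ (dualTensorIso X B).hom) ⊗ₘ g) ≫ (α_ (dualObj B) (dualObj X) (X ⊗ B)).hom ≫
    (dualObj B) ◁ ((α_ (dualObj X) X B).inv ≫ cap' X ▷ B ≫ (λ_ B).hom)

/-- The CP*-condition on a map `f : A ⟶ B` between (the carriers of) two algebras: there are an
object `X` and a Kraus map `g : A ⟶ X ⊗ B` with
`action_B ∘ f ∘ coaction_A = (B* ⊗ cap_X ⊗ B) ∘ (g_* ⊗ g)`. -/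
def CPStarCondition (A B : AlgebraData V) (f : A.carrier ⟶ B.carrier) : Prop :=
  ∃ (X : V) (g : A.carrier ⟶ X ⊗ B.carrier), A.coaction ≫ f ≫ B.action = krausDouble g

variable (V) in
/-- The objects of `CP*[V]`: normalisable dagger Frobenius algebras in `V`. -/
structure CPStar extends AlgebraData V where
  isNormalisableDaggerFrobenius : toAlgebraData.IsNormalisableDaggerFrobenius

/-- A dagger compact structure on the normalisable dagger Frobenius algebras in `V` *is `CP*[V]`*,
with `U` sending a morphism to its underlying map in `V`, when the morphisms are exactly the maps
of `V` satisfying the CP*-condition, and all the structure is the one of `V`.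

The objects `A ⊗ B`, `𝟙_` and `dualObj A` are asserted to be the tensor, unit and dual algebras; in
particular their carriers equal those formed in `V`. Along these equalities, `HEq` is equality of
morphisms of `V`. -/
structure IsCPStarStructure [Category.{v} (CPStar V)] [MonoidalCategory (CPStar V)]
    [SymmetricCategory (CPStar V)] [DaggerCompactCategory (CPStar V)]
    (U : ∀ {A B : CPStar V}, (A ⟶ B) → (A.carrier ⟶ B.carrier)) : Prop where
  injective : ∀ (A B : CPStar V) (φ ψ : A ⟶ B), U φ = U ψ → φ = ψ
  range : ∀ (A B : CPStar V) (f : A.carrier ⟶ B.carrier),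
    (∃ φ : A ⟶ B, U φ = f) ↔ CPStarCondition A.toAlgebraData B.toAlgebraData f
  map_id : ∀ A : CPStar V, U (𝟙 A) = 𝟙 A.carrier
  map_comp : ∀ (A B C : CPStar V) (φ : A ⟶ B) (ψ : B ⟶ C), U (φ ≫ ψ) = U φ ≫ U ψ
  map_dag : ∀ (A B : CPStar V) (φ : A ⟶ B), U (dag φ) = dag (U φ)
  tensorObj_eq : ∀ A B : CPStar V,
    (A ⊗ B).toAlgebraData = A.toAlgebraData.tensor B.toAlgebraData
  tensorUnit_eq : (𝟙_ (CPStar V)).toAlgebraData = AlgebraData.unit V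
  dualObj_eq : ∀ A : CPStar V, (dualObj A).toAlgebraData = A.toAlgebraData.dual
  map_tensorHom : ∀ (A B C D : CPStar V) (φ : A ⟶ B) (ψ : C ⟶ D), HEq (U (φ ⊗ₘ ψ)) (U φ ⊗ₘ U ψ)
  map_associator : ∀ A B C : CPStar V,
    HEq (U (α_ A B C).hom) (α_ A.carrier B.carrier C.carrier).hom
  map_leftUnitor : ∀ A : CPStar V, HEq (U (λ_ A).hom) (λ_ A.carrier).hom
  map_rightUnitor : ∀ A : CPStar V, HEq (U (ρ_ A).hom) (ρ_ A.carrier).hom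
  map_braiding : ∀ A B : CPStar V, HEq (U (β_ A B).hom) (β_ A.carrier B.carrier).hom
  map_cup : ∀ A : CPStar V, HEq (U (cup A)) (cup A.carrier)
  map_cap : ∀ A : CPStar V, HEq (U (cap A)) (cap A.carrier)

end DaggerCompact

/-! The proof trades the CP*-condition for ordinary positivity. For `f : A ⟶ B` let `choi f` be the
endomorphism `a ⊗ b ↦ ∑ a₁ ⊗ f(a₂) b` of `A ⊗ B`, where `∑ a₁ ⊗ a₂` is the comultiplication of `a`.
Bending wires with the Frobenius form of `B` and the duality of `A` turns `choi f` into the left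
side of the CP*-condition, and `h† ∘ h` into the double of a Kraus map. Both bendings are
reversible, so `f` satisfies the condition exactly when `choi f` is positive
(`cpStarCondition_iff`).

Bending works because `A ⟶ A*` induced by the form is unitary, and that needs a symmetric form.
Symmetry comes from the normaliser: the counit is the trace of left multiplication precomposed with
the central map `z²`, and this trace is cyclic (`mul_mulTrace`, `braiding_form`). The same unitary
identifies the dual algebra with the opposite one, so duals are again normalisable
(`toDual_isUnitaryHom`).

Closure of the morphisms is then a series of formulas for `choi`. The identity gives `μ† ∘ μ`, a
tensor product gives a conjugate of a tensor product, and a unitary multiplicative map gives a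
conjugate of the identity case, which covers the coherence isomorphisms. For a composite, `choi f ⊗
choi g` is conjugated by a copairing of the middle algebra twisted by `z`; the two copies of `z`
multiply to the `z²` that removes the resulting loop (`choi_comp`). The dagger transposes `choi f`
across a nested pairing, and transposition preserves positivity (`IsPositive.of_pairing`).
Multiplication by the copairing `μ† ∘ u` in `Aᵒᵖ ⊗ A` is `μ† ∘ μ`, which yields the cup; the cap is
its dagger up to a braiding. All equations between morphisms are inherited from `V`. -/

namespace DaggerCompact
open DaggerCategory (dag)

attribute [simp] DaggerCategory.dag_id DaggerCategory.dag_comp DaggerCategory.dag_dag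
  DaggerCompactCategory.dag_tensorHom DaggerCompactCategory.dag_associator
  DaggerCompactCategory.dag_leftUnitor DaggerCompactCategory.dag_rightUnitor
  DaggerCompactCategory.dag_braiding

/-! ### Dagger calculus and positive endomorphisms. -/

section DagLemmas

variable {V : Type u} [Category.{v} V] [MonoidalCategory V] [SymmetricCategory V]
  [DaggerCompactCategory V]

theorem dag_injective {A B : V} {f g : A ⟶ B} (h : dag f = dag g) : f = g := by
  rw [← DaggerCategory.dag_dag f, h, DaggerCategory.dag_dag]

@[simp] theorem dag_whiskerLeft (X : V) {Y Z : V} (f : Y ⟶ Z) : dag (X ◁ f) = X ◁ dag f := by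
  rw [← id_tensorHom, DaggerCompactCategory.dag_tensorHom, DaggerCategory.dag_id, id_tensorHom]

@[simp] theorem dag_whiskerRight {Y Z : V} (f : Y ⟶ Z) (X : V) : dag (f ▷ X) = dag f ▷ X := by
  rw [← tensorHom_id, DaggerCompactCategory.dag_tensorHom, DaggerCategory.dag_id, tensorHom_id]

@[simp] theorem dag_associator_inv (X Y Z : V) : dag (α_ X Y Z).inv = (α_ X Y Z).hom := by
  rw [← DaggerCompactCategory.dag_associator, DaggerCategory.dag_dag]

@[simp] theorem dag_leftUnitor_inv (X : V) : dag (λ_ X).inv = (λ_ X).hom := by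
  rw [← DaggerCompactCategory.dag_leftUnitor, DaggerCategory.dag_dag]

@[simp] theorem dag_rightUnitor_inv (X : V) : dag (ρ_ X).inv = (ρ_ X).hom := by
  rw [← DaggerCompactCategory.dag_rightUnitor, DaggerCategory.dag_dag]


theorem dag_braiding' (X Y : V) : dag (β_ X Y).hom = (β_ Y X).hom := by
  rw [DaggerCompactCategory.dag_braiding, SymmetricCategory.braiding_swap_eq_inv_braiding]

theorem dag_cup (X : V) : dag (cup X) = cap' X := by
  rw [← DaggerCompactCategory.dag_cap, DaggerCategory.dag_comp, DaggerCategory.dag_dag,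
    dag_braiding', cap']

theorem dag_tensorμ (X₁ X₂ Y₁ Y₂ : V) : dag (tensorμ X₁ X₂ Y₁ Y₂) = tensorμ X₁ Y₁ X₂ Y₂ := by
  simp [tensorμ, -DaggerCompactCategory.dag_braiding, dag_braiding']

/-- Morphisms into a dual are determined by their pairing with `cap`. -/
theorem eq_of_whiskerLeft_cap {X A : V} {f g : X ⟶ dualObj A}
    (h : A ◁ f ≫ cap A = A ◁ g ≫ cap A) : f = g := by
  simpa using congrArg (tensorLeftHomEquiv X (dualObj A) A (𝟙_ V)) h

/-- Morphisms into a dual are determined by their pairing with `cap'`. -/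
theorem eq_of_whiskerRight_cap' {X A : V} {f g : X ⟶ dualObj A}
    (h : f ▷ A ≫ cap' A = g ▷ A ≫ cap' A) : f = g := by
  have key : ∀ f : X ⟶ dualObj A, A ◁ f ≫ cap A = (β_ A X).hom ≫ f ▷ A ≫ cap' A := fun f => by
    rw [cap', BraidedCategory.braiding_naturality_left_assoc, SymmetricCategory.symmetry_assoc]
  exact eq_of_whiskerLeft_cap (by rw [key, key, h])

end DagLemmas

section Positive

variable {V : Type u} [Category.{v} V]

theorem IsPositive.conjugate [DaggerCategory V] {A B : V} {p : A ⟶ A} (hp : IsPositive p)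
    (k : B ⟶ A) : IsPositive (k ≫ p ≫ dag k) := by
  obtain ⟨X, h, rfl⟩ := hp
  exact ⟨X, k ≫ h, by simp⟩

theorem IsPositive.dag_eq [DaggerCategory V] {A : V} {p : A ⟶ A} (hp : IsPositive p) :
    dag p = p := by
  obtain ⟨X, h, rfl⟩ := hp
  simp

theorem IsPositive.id [DaggerCategory V] (A : V) : IsPositive (𝟙 A) :=
  ⟨A, 𝟙 A, by simp⟩

variable [MonoidalCategory V] [SymmetricCategory V] [DaggerCompactCategory V]

theorem IsPositive.tensor {A B : V} {p : A ⟶ A} {q : B ⟶ B} (hp : IsPositive p)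
    (hq : IsPositive q) : IsPositive (p ⊗ₘ q) := by
  obtain ⟨X, h, rfl⟩ := hp
  obtain ⟨Y, k, rfl⟩ := hq
  exact ⟨X ⊗ Y, h ⊗ₘ k, by simp⟩

end Positive

/-! ### The self-pairing of a dagger Frobenius algebra. -/

namespace AlgebraData

variable {V : Type u} [Category.{v} V] [MonoidalCategory V] [SymmetricCategory V]
  [DaggerCompactCategory V]

/-- The copairing `I ⟶ A ⊗ A` of an algebra with a dagger. -/
def casimir (A : AlgebraData V) : 𝟙_ V ⟶ A.carrier ⊗ A.carrier := A.one ≫ A.comul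

/-- The pairing `A ⊗ A ⟶ I` of an algebra with a dagger. -/
def form (A : AlgebraData V) : A.carrier ⊗ A.carrier ⟶ 𝟙_ V := A.mul ≫ A.counit

@[simp] theorem dag_mul (A : AlgebraData V) : dag A.mul = A.comul := rfl
@[simp] theorem dag_one (A : AlgebraData V) : dag A.one = A.counit := rfl
@[simp] theorem dag_comul (A : AlgebraData V) : dag A.comul = A.mul :=
  DaggerCategory.dag_dag _
@[simp] theorem dag_counit (A : AlgebraData V) : dag A.counit = A.one :=
  DaggerCategory.dag_dag _
@[simp] theorem dag_casimir (A : AlgebraData V) : dag A.casimir = A.form := by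
  simp [casimir, form]
@[simp] theorem dag_form (A : AlgebraData V) : dag A.form = A.casimir := by
  simp [casimir, form]

/-- The dagger Frobenius axioms, without a normaliser. -/
structure IsDaggerFrobenius (A : AlgebraData V) : Prop where
  mul_assoc : A.mul ▷ A.carrier ≫ A.mul =
    (α_ A.carrier A.carrier A.carrier).hom ≫ A.carrier ◁ A.mul ≫ A.mul
  one_mul : A.one ▷ A.carrier ≫ A.mul = (λ_ A.carrier).hom
  mul_one : A.carrier ◁ A.one ≫ A.mul = (ρ_ A.carrier).hom
  frobenius_left : A.carrier ◁ A.comul ≫ (α_ A.carrier A.carrier A.carrier).inv ≫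
    A.mul ▷ A.carrier = A.mul ≫ A.comul
  frobenius_right : A.comul ▷ A.carrier ≫ (α_ A.carrier A.carrier A.carrier).hom ≫
    A.carrier ◁ A.mul = A.mul ≫ A.comul

namespace IsDaggerFrobenius

variable {A : AlgebraData V} (hA : A.IsDaggerFrobenius)
include hA

theorem comul_counit_left : A.comul ≫ A.counit ▷ A.carrier = (λ_ A.carrier).inv := by
  apply dag_injective; simp [hA.one_mul]

theorem comul_counit_right : A.comul ≫ A.carrier ◁ A.counit = (ρ_ A.carrier).inv := by
  apply dag_injective; simp [hA.mul_one]

/-- This is a Frobenius law with the unit plugged into the comultiplied leg: the copairing and the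
product already determine the coproduct. -/
theorem comul_eq_left : (λ_ A.carrier).inv ≫ A.casimir ▷ A.carrier ≫
    (α_ A.carrier A.carrier A.carrier).hom ≫ A.carrier ◁ A.mul = A.comul := by
  rw [casimir, comp_whiskerRight_assoc, hA.frobenius_right, ← Category.assoc (A.one ▷ _),
    hA.one_mul, Iso.inv_hom_id_assoc]

theorem comul_eq_right : (ρ_ A.carrier).inv ≫ A.carrier ◁ A.casimir ≫
    (α_ A.carrier A.carrier A.carrier).inv ≫ A.mul ▷ A.carrier = A.comul := by
  rw [casimir, MonoidalCategory.whiskerLeft_comp_assoc, hA.frobenius_left,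
    ← Category.assoc (_ ◁ A.one), hA.mul_one, Iso.inv_hom_id_assoc]

/-- A snake equation: applying the counit to one output of `comul_eq_right` leaves the identity.
With `casimir_form` it makes the algebra self-dual, with no symmetry of the form required. -/
theorem form_casimir : (ρ_ A.carrier).inv ≫ A.carrier ◁ A.casimir ≫
    (α_ A.carrier A.carrier A.carrier).inv ≫ A.form ▷ A.carrier ≫ (λ_ _).hom = 𝟙 _ := by
  rw [form, comp_whiskerRight_assoc]
  have := hA.comul_eq_right
  simp only [← Category.assoc] at this ⊢
  rw [this, hA.comul_counit_left, Iso.inv_hom_id]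

theorem casimir_form : (λ_ A.carrier).inv ≫ A.casimir ▷ A.carrier ≫
    (α_ A.carrier A.carrier A.carrier).hom ≫ A.carrier ◁ A.form ≫ (ρ_ _).hom = 𝟙 _ := by
  rw [form, MonoidalCategory.whiskerLeft_comp_assoc]
  have := hA.comul_eq_left
  simp only [← Category.assoc] at this ⊢
  rw [this, hA.comul_counit_right, Iso.inv_hom_id]

theorem mul_form : A.mul ▷ A.carrier ≫ A.form =
    (α_ A.carrier A.carrier A.carrier).hom ≫ A.carrier ◁ A.mul ≫ A.form := by
  simp only [form, ← Category.assoc, hA.mul_assoc]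

/-- `f` is determined by the pairing `x ⊗ y ↦ form (x, f y)`. -/
theorem eq_of_whiskerLeft_form {X : V} {f g : X ⟶ A.carrier}
    (h : A.carrier ◁ f ≫ A.form = A.carrier ◁ g ≫ A.form) : f = g := by
  have key : ∀ f : X ⟶ A.carrier, f = (λ_ X).inv ≫ A.casimir ▷ X ≫
      (α_ A.carrier A.carrier X).hom ≫ A.carrier ◁ (A.carrier ◁ f ≫ A.form) ≫ (ρ_ _).hom := by
    intro f
    calc f = f ≫ 𝟙 _ := by simp
      _ = 𝟙 _ ⊗≫ (𝟙_ V ◁ f ≫ A.casimir ▷ A.carrier) ⊗≫ A.carrier ◁ A.form ⊗≫ 𝟙 _ := by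
          conv_lhs => rw [← hA.casimir_form]
          monoidal
      _ = _ := by rw [whisker_exchange]; monoidal
  rw [key f, h, ← key g]

end IsDaggerFrobenius

theorem IsNormalisableDaggerFrobenius.isDaggerFrobenius {A : AlgebraData V}
    (hA : A.IsNormalisableDaggerFrobenius) : A.IsDaggerFrobenius :=
  ⟨hA.mul_assoc, hA.one_mul, hA.mul_one, hA.frobenius_left, hA.frobenius_right⟩

end AlgebraData
end DaggerCompact

/-! ### Bending along the chosen duals, and cyclicity of the trace. -/

namespace DaggerCompact
open DaggerCategory (dag)

variable {V : Type u} [Category.{v} V] [MonoidalCategory V] [SymmetricCategory V]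
  [DaggerCompactCategory V]

/-- The pairing of `A` with `A*` by `cup'` and `cap'`. -/
@[reducible]
def swappedPairing (A : V) : ExactPairing A (dualObj A) where
  coevaluation' := cup' A
  evaluation' := cap' A
  coevaluation_evaluation' := by
    have := (BraidedCategory.exactPairing_swap (dualObj A) A).coevaluation_evaluation'
    rw [cup', SymmetricCategory.braiding_swap_eq_inv_braiding]
    exact this
  evaluation_coevaluation' := by
    have := (BraidedCategory.exactPairing_swap (dualObj A) A).evaluation_coevaluation'
    rw [cup', SymmetricCategory.braiding_swap_eq_inv_braiding]
    exact this

theorem cup'_cap' (A : V) : (cup' A) ▷ A ≫ (α_ A (dualObj A) A).hom ≫ A ◁ cap' A =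
    (λ_ A).hom ≫ (ρ_ A).inv :=
  (swappedPairing A).evaluation_coevaluation'

theorem eq_of_pairing_cap' {X B A : V} {f g : X ⟶ B ⊗ dualObj A}
    (h : f ▷ A ≫ (α_ _ _ _).hom ≫ B ◁ cap' A = g ▷ A ≫ (α_ _ _ _).hom ≫ B ◁ cap' A) : f = g := by
  let _ := swappedPairing A
  apply (tensorRightHomEquiv X A (dualObj A) B).symm.injective
  change f ▷ A ≫ (α_ _ _ _).hom ≫ B ◁ cap' A ≫ (ρ_ _).hom =
    g ▷ A ≫ (α_ _ _ _).hom ≫ B ◁ cap' A ≫ (ρ_ _).hom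
  simpa only [Category.assoc] using congrArg (· ≫ (ρ_ B).hom) h

theorem cap_eq (A : V) : cap A = (β_ A (dualObj A)).hom ≫ cap' A := by
  rw [cap', SymmetricCategory.symmetry_assoc]

/-- The transpose of `m : A ⊗ X ⟶ I` across the chosen dual. -/
def curryCap {A X : V} (m : A ⊗ X ⟶ 𝟙_ V) : X ⟶ dualObj A :=
  tensorLeftHomEquiv X (dualObj A) A (𝟙_ V) m ≫ (ρ_ _).hom

theorem curryCap_cap {A X : V} (m : A ⊗ X ⟶ 𝟙_ V) : A ◁ curryCap m ≫ cap A = m := by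
  apply (tensorLeftHomEquiv X (dualObj A) A (𝟙_ V)).injective
  rw [tensorLeftHomEquiv_whiskerLeft_comp_evaluation]
  simp [curryCap]

theorem curryCap_cap' {A X : V} (m : A ⊗ X ⟶ 𝟙_ V) :
    curryCap m ▷ A ≫ cap' A = (β_ X A).hom ≫ m := by
  rw [cap', BraidedCategory.braiding_naturality_left_assoc, curryCap_cap]

/-- The transpose of `m : X ⊗ A ⟶ I` across the chosen dual. -/
def curryCap' {A X : V} (m : X ⊗ A ⟶ 𝟙_ V) : X ⟶ dualObj A := curryCap ((β_ A X).hom ≫ m)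

theorem curryCap'_cap' {A X : V} (m : X ⊗ A ⟶ 𝟙_ V) : curryCap' m ▷ A ≫ cap' A = m := by
  rw [curryCap', curryCap_cap', SymmetricCategory.symmetry_assoc]

namespace AlgebraData

/-- The regular representation `y ↦ ∑ y eᵢ ⊗ eᵢ*`. -/
def leftRegular (A : AlgebraData V) : A.carrier ⟶ A.carrier ⊗ dualObj A.carrier :=
  (ρ_ A.carrier).inv ≫ A.carrier ◁ cup' A.carrier ≫
    (α_ A.carrier A.carrier (dualObj A.carrier)).inv ≫ A.mul ▷ (dualObj A.carrier)

/-- The right action of an algebra on its dual. -/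
def dualAction (A : AlgebraData V) : dualObj A.carrier ⊗ A.carrier ⟶ dualObj A.carrier :=
  curryCap' ((α_ _ _ _).hom ≫ dualObj A.carrier ◁ A.mul ≫ cap' A.carrier)

/-- An endomorphism slides around the cup to become its transpose: `∑ y eᵢ ⊗ eᵢ* = ∑ eᵢ ⊗ (eᵢ* ·
y)`, where `(φ · y)(b) = φ(y b)`. Associativity plays no role here. -/
theorem leftRegular_eq (A : AlgebraData V) : A.leftRegular =
    (λ_ A.carrier).inv ≫ cup' A.carrier ▷ A.carrier ≫ (α_ _ _ _).hom ≫
      A.carrier ◁ A.dualAction := by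
  apply eq_of_pairing_cap'
  calc
    _ = 𝟙 _ ⊗≫ A.carrier ◁ (cup' A.carrier ▷ A.carrier ≫ (α_ _ _ _).hom) ⊗≫
        (A.mul ▷ (dualObj A.carrier ⊗ A.carrier) ≫ A.carrier ◁ cap' A.carrier) := by
      rw [leftRegular]; monoidal
    _ = 𝟙 _ ⊗≫ A.carrier ◁ (cup' A.carrier ▷ A.carrier ≫ (α_ _ _ _).hom ≫ A.carrier ◁ cap' A.carrier)
          ⊗≫ A.mul ⊗≫ 𝟙 _ := by
      rw [← whisker_exchange]; monoidal
    _ = 𝟙 _ ⊗≫ 𝟙_ V ◁ A.mul ⊗≫ 𝟙 _ := by rw [cup'_cap']; monoidal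
    _ = 𝟙 _ ⊗≫ 𝟙_ V ◁ A.mul ≫ (cup' A.carrier ▷ A.carrier ≫ (α_ _ _ _).hom ≫
          A.carrier ◁ cap' A.carrier) := by rw [cup'_cap']; monoidal
    _ = 𝟙 _ ⊗≫ (𝟙_ V ◁ A.mul ≫ cup' A.carrier ▷ A.carrier) ≫ (α_ _ _ _).hom ≫
          A.carrier ◁ cap' A.carrier := by simp
    _ = 𝟙 _ ⊗≫ cup' A.carrier ▷ (A.carrier ⊗ A.carrier) ⊗≫
          A.carrier ◁ ((α_ _ _ _).hom ≫ dualObj A.carrier ◁ A.mul ≫ cap' A.carrier) := by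
      rw [whisker_exchange]; monoidal
    _ = _ := by
      rw [← curryCap'_cap' ((α_ _ _ _).hom ≫ dualObj A.carrier ◁ A.mul ≫ cap' A.carrier)]
      rw [← dualAction]; monoidal

theorem dualAction_cap (A : AlgebraData V) : A.carrier ◁ A.dualAction ≫ cap A.carrier =
    (α_ _ _ _).inv ≫ (β_ (A.carrier ⊗ dualObj A.carrier) A.carrier).hom ≫ (α_ _ _ _).inv ≫
      A.mul ▷ dualObj A.carrier ≫ cap A.carrier := by
  rw [cap_eq, BraidedCategory.braiding_naturality_right_assoc,
    BraidedCategory.braiding_naturality_left_assoc, dualAction, curryCap'_cap']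
  simp only [BraidedCategory.braiding_tensor_right_hom, BraidedCategory.braiding_tensor_left_hom,
    Category.assoc, Iso.inv_hom_id_assoc]
  rw [← BraidedCategory.yang_baxter_assoc, Iso.hom_inv_id_assoc, ← comp_whiskerRight_assoc,
    SymmetricCategory.symmetry]
  simp

/-- Cyclicity of the trace, `Tr(xy) = Tr(yx)`. Associativity rewrites the regular representation of
`xy` as `x` acting on that of `y`; sliding `y` around the cup then brings it back in front of `x`.
-/
theorem mul_mulTrace (A : AlgebraData V)
    (h : A.mul ▷ A.carrier ≫ A.mul =
    (α_ A.carrier A.carrier A.carrier).hom ≫ A.carrier ◁ A.mul ≫ A.mul) :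
    A.mul ≫ A.mulTrace = (β_ A.carrier A.carrier).hom ≫ A.mul ≫ A.mulTrace := by
  have h1 : A.mulTrace = A.leftRegular ≫ cap A.carrier := by simp [mulTrace, leftRegular]
  have h2 : A.mul ≫ A.leftRegular =
      A.carrier ◁ A.leftRegular ≫ (α_ _ _ _).inv ≫ A.mul ▷ _ := by
    calc
      _ = 𝟙 _ ⊗≫ (A.mul ▷ 𝟙_ V ≫ A.carrier ◁ cup' A.carrier) ⊗≫ A.mul ▷ dualObj A.carrier := by
        rw [leftRegular]; monoidal
      _ = 𝟙 _ ⊗≫ (A.carrier ⊗ A.carrier) ◁ cup' A.carrier ⊗≫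
           (A.mul ▷ A.carrier ≫ A.mul) ▷ dualObj A.carrier := by
        rw [← whisker_exchange]; monoidal
      _ = _ := by rw [h, leftRegular]; monoidal
  have h3 : A.mul ≫ A.mulTrace = A.carrier ◁ A.leftRegular ≫ (α_ _ _ _).inv ≫ A.mul ▷ _ ≫
      cap A.carrier := by rw [h1, reassoc_of% h2]
  -- Here `y` has travelled through the dual wire, so the value reads `∑ eᵢ*(y (x eᵢ))`. Comparison
  -- with `h3` after a braiding finishes the proof.
  have h4 : A.mul ≫ A.mulTrace = 𝟙 _ ⊗≫ A.leftRegular ▷ A.carrier ≫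
      (β_ (A.carrier ⊗ dualObj A.carrier) A.carrier).hom ≫ (α_ _ _ _).inv ≫
      A.mul ▷ dualObj A.carrier ≫ cap A.carrier := by
    rw [h3]
    calc
      _ = 𝟙 _ ⊗≫ A.carrier ◁ cup' A.carrier ▷ A.carrier ⊗≫
          ((A.carrier ⊗ A.carrier) ◁ A.dualAction ≫ A.mul ▷ dualObj A.carrier) ≫ cap A.carrier := by
        rw [leftRegular_eq]; monoidal
      _ = 𝟙 _ ⊗≫ A.leftRegular ▷ A.carrier ⊗≫ A.carrier ◁ A.dualAction ≫ cap A.carrier := by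
        rw [whisker_exchange, leftRegular]; monoidal
      _ = _ := by rw [dualAction_cap]; monoidal
  conv_lhs => rw [h4, BraidedCategory.braiding_naturality_left_assoc]
  conv_rhs => rw [h3]
  simp [monoidalComp]

end AlgebraData
end DaggerCompact

/-! ### Normalisers, symmetry of the form, and the unitary from an algebra to its dual. -/

namespace DaggerCompact
open DaggerCategory (dag)

variable {V : Type u} [Category.{v} V] [MonoidalCategory V] [SymmetricCategory V]
  [DaggerCompactCategory V]

namespace AlgebraData

/-- The map `A ⟶ A*` induced by the pairing of an algebra. -/
def toDual (A : AlgebraData V) : A.carrier ⟶ dualObj A.carrier := curryCap A.form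

theorem toDual_cap (A : AlgebraData V) :
    A.carrier ◁ A.toDual ≫ cap A.carrier = A.form := curryCap_cap _

theorem dag_toDual (A : AlgebraData V) : dag A.toDual = (ρ_ _).inv ≫ dualObj A.carrier ◁ A.casimir ≫
    (α_ _ _ _).inv ≫ cap' A.carrier ▷ A.carrier ≫ (λ_ _).hom := by
  rw [toDual, curryCap, tensorLeftHomEquiv]
  simp [dag_cup]

/-- The dual-free part of the axioms of a normaliser, together with a dual-free form of the
normalisation condition. -/
structure IsNormaliser (A : AlgebraData V) : Prop where
  central_left : A.normaliser ▷ A.carrier ≫ A.mul = A.mul ≫ A.normaliser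
  central_right : A.carrier ◁ A.normaliser ≫ A.mul = A.mul ≫ A.normaliser
  posDef : IsPositiveDefinite A.normaliser
  normalised : A.casimir ≫ (β_ A.carrier A.carrier).hom ≫ A.mul ≫ A.normaliser ≫ A.normaliser =
    A.one

namespace IsDaggerFrobenius

variable {A : AlgebraData V} (hA : A.IsDaggerFrobenius)
include hA

theorem casimir_toDual : A.casimir ≫ A.toDual ▷ A.carrier = cup A.carrier := by
  calc
    _ = 𝟙 _ ⊗≫ (𝟙_ V ◁ A.casimir ≫ cup A.carrier ▷ (A.carrier ⊗ A.carrier)) ⊗≫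
        dualObj A.carrier ◁ A.form ▷ A.carrier ⊗≫ 𝟙 _ := by
      simp only [toDual, curryCap, tensorLeftHomEquiv, Equiv.coe_fn_mk]; monoidal
    _ = cup A.carrier ≫ dualObj A.carrier ◁ ((ρ_ A.carrier).inv ≫ A.carrier ◁ A.casimir ≫
    (α_ A.carrier A.carrier A.carrier).inv ≫ A.form ▷ A.carrier ≫ (λ_ _).hom) := by
      rw [whisker_exchange]; monoidal
    _ = _ := by rw [hA.form_casimir]; simp

/-- Replacing the dual by the self-duality writes the trace as the form against a fixed element, the
product of the braided copairing. The normalisation axiom thereby becomes an equation between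
elements, as in `IsNormaliser`. -/
theorem mulTrace_eq : A.mulTrace = (ρ_ A.carrier).inv ≫
    A.carrier ◁ (A.casimir ≫ (β_ A.carrier A.carrier).hom ≫ A.mul) ≫ A.form := by
  have h : cup' A.carrier = A.casimir ≫ (β_ A.carrier A.carrier).hom ≫ A.carrier ◁ A.toDual := by
    rw [cup', ← hA.casimir_toDual, Category.assoc, BraidedCategory.braiding_naturality_left]
  calc
    _ = 𝟙 _ ⊗≫ A.carrier ◁ (A.casimir ≫ (β_ A.carrier A.carrier).hom) ⊗≫
        ((A.carrier ⊗ A.carrier) ◁ A.toDual ≫ A.mul ▷ dualObj A.carrier) ≫ cap A.carrier := by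
      rw [mulTrace, h]; monoidal
    _ = (ρ_ A.carrier).inv ≫ A.carrier ◁ (A.casimir ≫ (β_ A.carrier A.carrier).hom) ≫
          (α_ _ _ _).inv ≫ A.mul ▷ A.carrier ≫ A.form := by
      rw [whisker_exchange, Category.assoc, toDual_cap]; monoidal
    _ = _ := by rw [hA.mul_form]; monoidal

theorem action_eq : A.action = A.comul ≫ A.toDual ▷ A.carrier := by
  rw [action, ← hA.casimir_toDual, ← hA.comul_eq_left]
  calc
    _ = 𝟙 _ ⊗≫ A.casimir ▷ A.carrier ⊗≫ (A.toDual ▷ (A.carrier ⊗ A.carrier) ≫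
          dualObj A.carrier ◁ A.mul) := by monoidal
    _ = _ := by rw [← whisker_exchange]; monoidal

theorem rightUnit_form : (ρ_ A.carrier).inv ≫ A.carrier ◁ A.one ≫ A.form = A.counit := by
  rw [form, reassoc_of% hA.mul_one, Iso.inv_hom_id_assoc]

theorem isNormalisableDaggerFrobenius (hz : A.IsNormaliser) :
    A.IsNormalisableDaggerFrobenius := by
  have h1 : A.normaliser ▷ A.carrier ≫ A.form = A.carrier ◁ A.normaliser ≫ A.form := by
    rw [form, reassoc_of% hz.central_left, reassoc_of% hz.central_right]
  refine ⟨hA.mul_assoc, hA.one_mul, hA.mul_one, hA.frobenius_left, hA.frobenius_right,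
    hz.central_left, hz.central_right, hz.posDef, ?_⟩
  rw [hA.mulTrace_eq, rightUnitor_inv_naturality_assoc, rightUnitor_inv_naturality_assoc,
    ← whisker_exchange_assoc, ← whisker_exchange_assoc, h1, ← whisker_exchange_assoc, h1,
    ← MonoidalCategory.whiskerLeft_comp_assoc, ← MonoidalCategory.whiskerLeft_comp_assoc]
  simp only [Category.assoc]
  rw [hz.normalised, hA.rightUnit_form]

end IsDaggerFrobenius

namespace IsNormalisableDaggerFrobenius

variable {A : AlgebraData V} (hA : A.IsNormalisableDaggerFrobenius)
include hA

theorem normaliser_form : A.normaliser ▷ A.carrier ≫ A.form = A.carrier ◁ A.normaliser ≫ A.form := by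
  rw [form, reassoc_of% hA.central_left, reassoc_of% hA.central_right]

/-- Centrality moves both copies of the normaliser to the other leg of the form, and nondegeneracy
then cancels the form. -/
theorem isNormaliser : A.IsNormaliser := by
  refine ⟨hA.central_left, hA.central_right, hA.posDef, ?_⟩
  have hF := hA.isDaggerFrobenius
  have h1 := hA.normaliser_form
  have h := hA.normalised
  rw [hF.mulTrace_eq, rightUnitor_inv_naturality_assoc, rightUnitor_inv_naturality_assoc,
    ← whisker_exchange_assoc, ← whisker_exchange_assoc, h1, ← whisker_exchange_assoc, h1,
    ← MonoidalCategory.whiskerLeft_comp_assoc, ← MonoidalCategory.whiskerLeft_comp_assoc,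
    ← hF.rightUnit_form, Iso.cancel_iso_inv_left] at h
  simpa using hF.eq_of_whiskerLeft_form h

/-- The form is `Tr(z² x y)`. Since `z` is central it can be put on either factor, so cyclicity of
the trace makes the form symmetric. Every later use of symmetry rests on this. -/
theorem braiding_form : (β_ A.carrier A.carrier).hom ≫ A.form = A.form := by
  have h := mul_mulTrace A hA.mul_assoc
  have hz : A.mul ≫ A.normaliser ≫ A.normaliser =
      (A.normaliser ≫ A.normaliser) ▷ A.carrier ≫ A.mul := by
    rw [comp_whiskerRight_assoc, hA.central_left, reassoc_of% hA.central_left]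
  have hz' : A.mul ≫ A.normaliser ≫ A.normaliser =
      A.carrier ◁ (A.normaliser ≫ A.normaliser) ≫ A.mul := by
    rw [MonoidalCategory.whiskerLeft_comp_assoc, hA.central_right, reassoc_of% hA.central_right]
  have e : A.form = (A.mul ≫ A.normaliser ≫ A.normaliser) ≫ A.mulTrace := by
    rw [form, ← hA.normalised]; simp only [Category.assoc]
  conv_rhs => rw [e, hz, Category.assoc, h, BraidedCategory.braiding_naturality_left_assoc,
    ← Category.assoc (_ ◁ _), ← hz', ← e]

theorem casimir_braiding : A.casimir ≫ (β_ A.carrier A.carrier).hom = A.casimir := by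
  apply dag_injective
  rw [DaggerCategory.dag_comp, dag_braiding', dag_casimir, hA.braiding_form]

theorem toDual_cap' : A.toDual ▷ A.carrier ≫ cap' A.carrier = A.form := by
  rw [toDual, curryCap_cap', hA.braiding_form]

/-- The dagger of `toDual` is built from the copairing and `cap'`. Symmetry lets `toDual` be
evaluated against `cap'`, where the composite becomes a snake of the form. -/
theorem toDual_dag : A.toDual ≫ dag A.toDual = 𝟙 _ := by
  rw [dag_toDual]
  calc
    _ = 𝟙 _ ⊗≫ (A.toDual ▷ 𝟙_ V ≫ dualObj A.carrier ◁ A.casimir) ⊗≫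
        cap' A.carrier ▷ A.carrier ⊗≫ 𝟙 _ := by monoidal
    _ = 𝟙 _ ⊗≫ A.carrier ◁ A.casimir ⊗≫ (A.toDual ▷ A.carrier ≫
        cap' A.carrier) ▷ A.carrier ⊗≫ 𝟙 _ := by rw [← whisker_exchange]; monoidal
    _ = (ρ_ A.carrier).inv ≫ A.carrier ◁ A.casimir ≫
    (α_ A.carrier A.carrier A.carrier).inv ≫ A.form ▷ A.carrier ≫ (λ_ _).hom := by
      rw [hA.toDual_cap']; monoidal
    _ = _ := hA.isDaggerFrobenius.form_casimir

theorem dag_toDual_comp : dag A.toDual ≫ A.toDual = 𝟙 _ := by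
  apply eq_of_whiskerRight_cap'
  rw [comp_whiskerRight, Category.assoc, hA.toDual_cap', dag_toDual]
  calc
    _ = 𝟙 _ ⊗≫ dualObj A.carrier ◁ A.casimir ▷ A.carrier ⊗≫
        (cap' A.carrier ▷ (A.carrier ⊗ A.carrier) ≫ 𝟙_ V ◁ A.form) ⊗≫ 𝟙 _ := by
      monoidal
    _ = dualObj A.carrier ◁ ((λ_ A.carrier).inv ≫ A.casimir ▷ A.carrier ≫
    (α_ A.carrier A.carrier A.carrier).hom ≫ A.carrier ◁ A.form ≫ (ρ_ _).hom) ≫ cap' _ := by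
      rw [← whisker_exchange]; monoidal
    _ = _ := by rw [hA.isDaggerFrobenius.casimir_form]; simp

end IsNormalisableDaggerFrobenius
end AlgebraData
end DaggerCompact

/-! ### Tensor, unit and opposite algebras, and transport along unitary maps. -/

namespace DaggerCompact
open DaggerCategory (dag)

variable {V : Type u} [Category.{v} V] [MonoidalCategory V] [SymmetricCategory V]
  [DaggerCompactCategory V]

omit [DaggerCompactCategory V] in
theorem tensorδ_eq_tensorμ (X₁ X₂ Y₁ Y₂ : V) : tensorδ X₁ X₂ Y₁ Y₂ = tensorμ X₁ Y₁ X₂ Y₂ := by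
  simp [tensorμ, tensorδ, SymmetricCategory.braiding_swap_eq_inv_braiding X₂ Y₁]

omit [DaggerCompactCategory V] in
instance (X₁ X₂ Y₁ Y₂ : V) : IsIso (tensorμ X₁ X₂ Y₁ Y₂) :=
  ⟨tensorδ X₁ X₂ Y₁ Y₂, by simp, by simp⟩

omit [DaggerCompactCategory V] in
-- Associativity of the middle-four interchange with two of its shuffles inverted, the shape in
-- which the Frobenius law of a tensor product meets it.
theorem whiskerLeft_tensorδ (X₁ X₂ Y₁ Y₂ Z₁ Z₂ : V) :
    (X₁ ⊗ X₂) ◁ tensorδ Y₁ Y₂ Z₁ Z₂ ≫ (α_ _ _ _).inv ≫ tensorμ X₁ X₂ Y₁ Y₂ ▷ (Z₁ ⊗ Z₂) =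
      tensorμ X₁ X₂ (Y₁ ⊗ Z₁) (Y₂ ⊗ Z₂) ≫ ((α_ _ _ _).inv ⊗ₘ (α_ _ _ _).inv) ≫
        tensorδ (X₁ ⊗ Y₁) (X₂ ⊗ Y₂) Z₁ Z₂ := by
  have h := congrArg (fun t => (X₁ ⊗ X₂) ◁ tensorδ Y₁ Y₂ Z₁ Z₂ ≫ (α_ _ _ _).inv ≫ t ≫
    ((α_ _ _ _).inv ⊗ₘ (α_ _ _ _).inv) ≫ tensorδ (X₁ ⊗ Y₁) (X₂ ⊗ Y₂) Z₁ Z₂)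
    (tensor_associativity X₁ X₂ Y₁ Y₂ Z₁ Z₂)
  simp only [Category.assoc, Iso.inv_hom_id_assoc, ← whiskerLeft_comp_assoc, tensorδ_tensorμ,
    whiskerLeft_id, Category.id_comp, tensorHom_comp_tensorHom_assoc, Iso.hom_inv_id,
    id_tensorHom_id, tensorμ_tensorδ, Category.comp_id] at h
  exact h

namespace AlgebraData

/-- The two Frobenius laws are daggers of each other, so one suffices. -/
theorem IsDaggerFrobenius.of_frobenius_left {A : AlgebraData V}
    (mul_assoc : A.mul ▷ A.carrier ≫ A.mul =
      (α_ A.carrier A.carrier A.carrier).hom ≫ A.carrier ◁ A.mul ≫ A.mul)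
    (one_mul : A.one ▷ A.carrier ≫ A.mul = (λ_ A.carrier).hom)
    (mul_one : A.carrier ◁ A.one ≫ A.mul = (ρ_ A.carrier).hom)
    (frobenius_left : A.carrier ◁ A.comul ≫ (α_ A.carrier A.carrier A.carrier).inv ≫
      A.mul ▷ A.carrier = A.mul ≫ A.comul) : A.IsDaggerFrobenius :=
  ⟨mul_assoc, one_mul, mul_one, frobenius_left, by simpa using congrArg dag frobenius_left⟩

section Tensor

variable {A B : AlgebraData V}

theorem tensor_comul (A B : AlgebraData V) : (A.tensor B).comul =
    (A.comul ⊗ₘ B.comul) ≫ tensorδ A.carrier B.carrier A.carrier B.carrier := by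
  rw [tensorδ_eq_tensorμ]
  change dag (tensorμ _ _ _ _ ≫ (A.mul ⊗ₘ B.mul)) = _
  simp [dag_tensorμ]

theorem IsDaggerFrobenius.tensor (hA : A.IsDaggerFrobenius) (hB : B.IsDaggerFrobenius) :
    (A.tensor B).IsDaggerFrobenius := by
  let _ : MonObj A.carrier := ⟨A.one, A.mul, hA.one_mul, hA.mul_one, hA.mul_assoc⟩
  let _ : MonObj B.carrier := ⟨B.one, B.mul, hB.one_mul, hB.mul_one, hB.mul_assoc⟩
  refine .of_frobenius_left (MonObj.Mon_tensor_mul_assoc A.carrier B.carrier)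
    (MonObj.Mon_tensor_one_mul A.carrier B.carrier)
    (MonObj.Mon_tensor_mul_one A.carrier B.carrier) ?_
  rw [tensor_comul]
  dsimp only [AlgebraData.tensor]
  rw [whiskerLeft_comp_assoc, comp_whiskerRight, reassoc_of% whiskerLeft_tensorδ,
    tensorμ_natural_right_assoc]
  have h : tensorδ (A.carrier ⊗ A.carrier) (B.carrier ⊗ B.carrier) A.carrier B.carrier ≫
      (A.mul ⊗ₘ B.mul) ▷ (A.carrier ⊗ B.carrier) = (A.mul ▷ A.carrier ⊗ₘ B.mul ▷ B.carrier) ≫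
      tensorδ A.carrier B.carrier A.carrier B.carrier := by
    have := tensorμ_natural_left A.mul B.mul A.carrier B.carrier
    rw [← cancel_mono (tensorμ A.carrier B.carrier A.carrier B.carrier)]
    rw [Category.assoc, this, tensorδ_tensorμ_assoc, Category.assoc, tensorδ_tensorμ, Category.comp_id]
  rw [h, tensorHom_comp_tensorHom_assoc, tensorHom_comp_tensorHom_assoc, Category.assoc,
    Category.assoc, hA.frobenius_left, hB.frobenius_left]
  simp

theorem IsNormaliser.tensor (hA : A.IsNormaliser) (hB : B.IsNormaliser) :
    (A.tensor B).IsNormaliser := by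
  refine ⟨?_, ?_, ⟨hA.posDef.1.tensor hB.posDef.1, ?_⟩, ?_⟩
  · dsimp only [AlgebraData.tensor]
    rw [tensorμ_natural_left_assoc, tensorHom_comp_tensorHom, hA.central_left, hB.central_left]
    simp
  · dsimp only [AlgebraData.tensor]
    rw [tensorμ_natural_right_assoc, tensorHom_comp_tensorHom, hA.central_right, hB.central_right]
    simp
  · have := hA.posDef.2
    have := hB.posDef.2
    dsimp only [AlgebraData.tensor]
    infer_instance
  · rw [casimir, tensor_comul]
    -- The shuffles on either side of the braiding cancel, splitting the normalisation condition
    -- into one for each factor.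
    have hβ : tensorδ A.carrier B.carrier A.carrier B.carrier ≫
        (β_ (A.carrier ⊗ B.carrier) (A.carrier ⊗ B.carrier)).hom ≫
          tensorμ A.carrier B.carrier A.carrier B.carrier =
        (β_ A.carrier A.carrier).hom ⊗ₘ (β_ B.carrier B.carrier).hom := by
      rw [tensorδ_eq_tensorμ, reassoc_of% SymmetricCategory.tensorμ_braid_swap,
        ← tensorδ_eq_tensorμ, tensorδ_tensorμ, Category.comp_id]
    dsimp only [AlgebraData.tensor]
    simp only [Category.assoc, reassoc_of% hβ, tensorHom_comp_tensorHom]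
    have h1 := hA.normalised
    have h2 := hB.normalised
    simp only [casimir, Category.assoc] at h1 h2
    rw [h1, h2]

end Tensor

section Unit

theorem unit_isDaggerFrobenius : (unit V).IsDaggerFrobenius := by
  refine .of_frobenius_left ?_ ?_ ?_ ?_ <;> simp [unit, comul, -dag_mul]
  monoidal

theorem unit_isNormaliser : (unit V).IsNormaliser := by
  refine ⟨?_, ?_, ⟨IsPositive.id _, ?_⟩, ?_⟩ <;> simp [unit, casimir, comul, -dag_mul]
  · infer_instance
  · monoidal

end Unit

/-- The opposite algebra. -/
def op (A : AlgebraData V) : AlgebraData V where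
  carrier := A.carrier
  mul := (β_ A.carrier A.carrier).hom ≫ A.mul
  one := A.one
  normaliser := A.normaliser

section Op

variable {A : AlgebraData V}

theorem op_comul (A : AlgebraData V) : A.op.comul = A.comul ≫ (β_ A.carrier A.carrier).hom := by
  simp only [op, comul, DaggerCategory.dag_comp, dag_braiding']

theorem IsDaggerFrobenius.op (hA : A.IsDaggerFrobenius) : A.op.IsDaggerFrobenius := by
  refine .of_frobenius_left ?_ ?_ ?_ ?_
  · dsimp only [AlgebraData.op]
    simp only [comp_whiskerRight, Category.assoc, BraidedCategory.braiding_naturality_left_assoc,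
      whiskerLeft_comp, BraidedCategory.braiding_naturality_right_assoc, hA.mul_assoc,
      BraidedCategory.braiding_tensor_left_hom, BraidedCategory.braiding_tensor_right_hom]
    rw [← BraidedCategory.yang_baxter_assoc]
    simp only [Iso.hom_inv_id_assoc, Iso.inv_hom_id_assoc]
  · dsimp only [AlgebraData.op]
    rw [BraidedCategory.braiding_naturality_left_assoc, hA.mul_one]
    simp
  · dsimp only [AlgebraData.op]
    rw [BraidedCategory.braiding_naturality_right_assoc, hA.one_mul]
    simp
  · rw [op_comul]
    dsimp only [AlgebraData.op]
    rw [Category.assoc, ← reassoc_of% hA.frobenius_right, BraidedCategory.braiding_naturality_right,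
      ← BraidedCategory.braiding_naturality_right_assoc, whiskerLeft_comp_assoc, comp_whiskerRight]
    simp only [BraidedCategory.braiding_tensor_right_hom, Category.assoc,
      Iso.inv_hom_id_assoc]
    rw [BraidedCategory.yang_baxter_assoc, ← whiskerLeft_comp_assoc A.carrier (β_ _ _).hom,
      SymmetricCategory.symmetry, whiskerLeft_id, Category.id_comp, Iso.hom_inv_id_assoc]

theorem IsNormaliser.op (hA : A.IsNormaliser) : A.op.IsNormaliser := by
  refine ⟨?_, ?_, hA.posDef, ?_⟩
  · dsimp only [AlgebraData.op]
    rw [BraidedCategory.braiding_naturality_left_assoc, hA.central_right, Category.assoc]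
  · dsimp only [AlgebraData.op]
    rw [BraidedCategory.braiding_naturality_right_assoc, hA.central_left, Category.assoc]
  · rw [casimir, op_comul]
    dsimp only [AlgebraData.op]
    simpa [casimir] using hA.normalised

end Op

/-- A unitary multiplicative map of algebras. -/
structure IsUnitaryHom (A B : AlgebraData V) (e : A.carrier ⟶ B.carrier) : Prop where
  hom_dag : e ≫ dag e = 𝟙 _
  dag_hom : dag e ≫ e = 𝟙 _
  mul_hom : A.mul ≫ e = (e ⊗ₘ e) ≫ B.mul

namespace IsUnitaryHom

variable {A B : AlgebraData V} {e : A.carrier ⟶ B.carrier} (he : IsUnitaryHom A B e)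
include he

theorem dag_mul_hom : (dag e ⊗ₘ dag e) ≫ A.mul = B.mul ≫ dag e := by
  have : (dag e ⊗ₘ dag e) ≫ A.mul ≫ e ≫ dag e = (dag e ⊗ₘ dag e) ≫ (e ⊗ₘ e) ≫ B.mul ≫ dag e := by
    rw [reassoc_of% he.mul_hom]
  simpa [he.hom_dag, he.dag_hom, tensorHom_comp_tensorHom_assoc] using this

/-- The inverse is the dagger and is multiplicative as well; its multiplicativity, daggered, is this
comultiplicativity. -/
theorem comul_hom : e ≫ B.comul = A.comul ≫ (e ⊗ₘ e) := by
  simpa using (congrArg dag he.dag_mul_hom).symm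

theorem isDaggerFrobenius (h1 : A.one ≫ e = B.one) (hA : A.IsDaggerFrobenius) :
    B.IsDaggerFrobenius := by
  have : IsIso e := ⟨dag e, he.hom_dag, he.dag_hom⟩
  have a1 : ((e ⊗ₘ e) ⊗ₘ e) ≫ B.mul ▷ B.carrier = A.mul ▷ A.carrier ≫ (e ⊗ₘ e) := by
    simp only [← tensorHom_id, tensorHom_comp_tensorHom, he.mul_hom, Category.comp_id,
      Category.id_comp]
  have a2 : (e ⊗ₘ e ⊗ₘ e) ≫ B.carrier ◁ B.mul = A.carrier ◁ A.mul ≫ (e ⊗ₘ e) := by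
    simp only [← id_tensorHom, tensorHom_comp_tensorHom, he.mul_hom, Category.comp_id,
      Category.id_comp]
  have a3 : (e ⊗ₘ e) ≫ B.carrier ◁ B.comul = A.carrier ◁ A.comul ≫ (e ⊗ₘ e ⊗ₘ e) := by
    simp only [← id_tensorHom, tensorHom_comp_tensorHom, he.comul_hom, Category.comp_id,
      Category.id_comp]
  refine .of_frobenius_left ?_ ?_ ?_ ?_
  · rw [← cancel_epi ((e ⊗ₘ e) ⊗ₘ e), reassoc_of% a1, ← he.mul_hom, reassoc_of% hA.mul_assoc,
      associator_naturality_assoc, reassoc_of% a2, he.mul_hom]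
  · rw [← cancel_epi (𝟙_ V ◁ e), ← h1, whisker_exchange_assoc, comp_whiskerRight_assoc,
      ← tensorHom_def_assoc, ← he.mul_hom, reassoc_of% hA.one_mul, leftUnitor_naturality]
  · rw [← cancel_epi (e ▷ 𝟙_ V), ← h1, ← whisker_exchange_assoc, whiskerLeft_comp_assoc,
      ← tensorHom_def'_assoc, ← he.mul_hom, reassoc_of% hA.mul_one, rightUnitor_naturality]
  · rw [← cancel_epi (e ⊗ₘ e), reassoc_of% a3, associator_inv_naturality_assoc, a1,
      reassoc_of% hA.frobenius_left, ← reassoc_of% he.mul_hom, he.comul_hom]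

theorem isNormaliser (h1 : A.one ≫ e = B.one)
    (hz : A.normaliser ≫ e = e ≫ B.normaliser) (hA : A.IsNormaliser) :
    B.IsNormaliser := by
  have : IsIso e := ⟨dag e, he.hom_dag, he.dag_hom⟩
  -- The double dagger matches the shape `k ≫ p ≫ dag k` of `IsPositive.conjugate` with `k = dag e`.
  have hz' : B.normaliser = dag e ≫ A.normaliser ≫ dag (dag e) := by
    rw [DaggerCategory.dag_dag, hz, reassoc_of% he.dag_hom]
  have := hA.posDef.2
  have : IsIso (dag e) := ⟨e, he.dag_hom, he.hom_dag⟩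
  refine ⟨?_, ?_, ⟨?_, ?_⟩, ?_⟩
  · rw [← cancel_epi (e ⊗ₘ e), ← reassoc_of% he.mul_hom, ← hz, ← reassoc_of% hA.central_left,
      he.mul_hom, ← tensorHom_id, ← tensorHom_id, tensorHom_comp_tensorHom_assoc,
      tensorHom_comp_tensorHom_assoc, hz, Category.comp_id, Category.id_comp]
  · rw [← cancel_epi (e ⊗ₘ e), ← reassoc_of% he.mul_hom, ← hz, ← reassoc_of% hA.central_right,
      he.mul_hom, ← id_tensorHom, ← id_tensorHom, tensorHom_comp_tensorHom_assoc,
      tensorHom_comp_tensorHom_assoc, hz, Category.comp_id, Category.id_comp]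
  · rw [hz']
    exact hA.posDef.1.conjugate _
  · rw [hz', DaggerCategory.dag_dag]
    infer_instance
  · have h2 : B.casimir = A.casimir ≫ (e ⊗ₘ e) := by
      rw [casimir, ← h1, Category.assoc, he.comul_hom, casimir, Category.assoc]
    rw [h2, Category.assoc, BraidedCategory.braiding_naturality_assoc, ← reassoc_of% he.mul_hom,
      ← reassoc_of% hz, ← hz, reassoc_of% hA.normalised, h1]

end IsUnitaryHom

end AlgebraData
end DaggerCompact

/-! ### The dual algebra as a unitary copy of the opposite algebra. -/

namespace DaggerCompact
open DaggerCategory (dag)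

section
variable {V : Type u} [Category.{v} V] [MonoidalCategory V] [LeftRigidCategory V]

/-- The inverse of `dualTensorIso` is the mate of the identity between two duals of `A ⊗ B`, so
evaluation turns it into the nested caps. -/
theorem dualTensorIso_inv_cap (A B : V) :
    (A ⊗ B) ◁ (dualTensorIso A B).inv ≫ cap (A ⊗ B) =
      𝟙 _ ⊗≫ A ◁ cap B ▷ dualObj A ⊗≫ cap A := by
  have := @leftAdjointMate_comp_evaluation V _ _ (A ⊗ B) (A ⊗ B)
    (LeftRigidCategory.leftDual (A ⊗ B))
    (@HasLeftDual.mk _ _ _ _ (dualObj B ⊗ dualObj A) ExactPairing.tensor) (𝟙 _)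
  refine this.trans ?_
  rw [id_whiskerRight, Category.id_comp]
  simp [monoidalComp, ExactPairing.tensor_evaluation]

end

variable {V : Type u} [Category.{v} V] [MonoidalCategory V] [SymmetricCategory V]
  [DaggerCompactCategory V]

namespace AlgebraData

variable {A : AlgebraData V}

theorem IsDaggerFrobenius.comul_form (hA : A.IsDaggerFrobenius) :
    A.comul ▷ A.carrier ≫ (α_ _ _ _).hom ≫ A.carrier ◁ A.form ≫ (ρ_ _).hom = A.mul := by
  rw [form, whiskerLeft_comp_assoc, reassoc_of% hA.frobenius_right,
    reassoc_of% hA.comul_counit_right, Iso.inv_hom_id, Category.comp_id]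

theorem toDual_tensor_cap (A : AlgebraData V) :
    (A.carrier ⊗ A.carrier) ◁ ((A.toDual ⊗ₘ A.toDual) ≫ (dualTensorIso _ _).inv) ≫ cap _ =
      𝟙 _ ⊗≫ A.carrier ◁ A.form ▷ A.carrier ⊗≫ A.form := by
  rw [whiskerLeft_comp_assoc, dualTensorIso_inv_cap, ← toDual_cap]
  calc
    _ = 𝟙 _ ⊗≫ A.carrier ◁ A.carrier ◁ A.toDual ▷ A.carrier ⊗≫
        A.carrier ◁ ((A.carrier ⊗ dualObj A.carrier) ◁ A.toDual ≫ cap A.carrier ▷ dualObj A.carrier) ⊗≫ cap A.carrier := by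
      rw [MonoidalCategory.tensorHom_def]; monoidal
    _ = _ := by rw [whisker_exchange]; monoidal

namespace IsNormalisableDaggerFrobenius

variable (hA : A.IsNormalisableDaggerFrobenius)
include hA

/-- Paired with a further `A ⊗ A`, both sides become the form of two products. The transposed
comultiplication supplies one of them through `comul_form`, and associativity of the form does the
rest. -/
theorem toDual_mul : A.mul ≫ A.toDual =
    (A.toDual ⊗ₘ A.toDual) ≫ (dualTensorIso _ _).inv ≫ transpose A.comul := by
  apply eq_of_whiskerLeft_cap
  have hF := hA.isDaggerFrobenius
  rw [whiskerLeft_comp_assoc, toDual_cap, ← Category.assoc (_ ⊗ₘ _), whiskerLeft_comp_assoc,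
    leftAdjointMate_comp_evaluation, whisker_exchange_assoc, toDual_tensor_cap]
  calc
    _ = (α_ _ _ _).inv ≫ A.mul ▷ A.carrier ≫ A.form := by rw [hF.mul_form]; simp
    _ = 𝟙 _ ⊗≫ (A.comul ▷ A.carrier ≫ (α_ _ _ _).hom ≫ A.carrier ◁ A.form ≫ (ρ_ _).hom) ▷
        A.carrier ≫ A.form := by rw [hF.comul_form]; monoidal
    _ = _ := by monoidal

/-- The opposite algebra appears because the product of `A.dual` begins with a braiding, whereas
`toDual_mul` has none. -/
theorem toDual_isUnitaryHom : IsUnitaryHom A.op A.dual A.toDual := by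
  refine ⟨hA.toDual_dag, hA.dag_toDual_comp, ?_⟩
  dsimp only [op, dual]
  rw [Category.assoc, hA.toDual_mul, BraidedCategory.braiding_naturality_assoc]

theorem toDual_one : A.one ≫ A.toDual = A.dual.one := by
  have hF := hA.isDaggerFrobenius
  dsimp only [dual]
  rw [← hF.casimir_toDual, casimir, Category.assoc, Category.assoc, ← whisker_exchange_assoc,
    reassoc_of% hF.comul_counit_right]
  simp

theorem toDual_normaliser : A.normaliser ≫ A.toDual = A.toDual ≫ transpose A.normaliser := by
  apply eq_of_whiskerLeft_cap
  rw [whiskerLeft_comp_assoc, toDual_cap, whiskerLeft_comp_assoc, leftAdjointMate_comp_evaluation,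
    whisker_exchange_assoc, toDual_cap, hA.normaliser_form]

theorem op : A.op.IsNormalisableDaggerFrobenius :=
  hA.isDaggerFrobenius.op.isNormalisableDaggerFrobenius hA.isNormaliser.op

theorem dual : A.dual.IsNormalisableDaggerFrobenius :=
  (hA.toDual_isUnitaryHom.isDaggerFrobenius hA.toDual_one hA.op.isDaggerFrobenius
    ).isNormalisableDaggerFrobenius (hA.toDual_isUnitaryHom.isNormaliser hA.toDual_one
      hA.toDual_normaliser hA.op.isNormaliser)

theorem tensor {B : AlgebraData V} (hB : B.IsNormalisableDaggerFrobenius) :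
    (A.tensor B).IsNormalisableDaggerFrobenius :=
  (hA.isDaggerFrobenius.tensor hB.isDaggerFrobenius).isNormalisableDaggerFrobenius
    (hA.isNormaliser.tensor hB.isNormaliser)

end IsNormalisableDaggerFrobenius

theorem unit_isNormalisableDaggerFrobenius : (unit V).IsNormalisableDaggerFrobenius :=
  unit_isDaggerFrobenius.isNormalisableDaggerFrobenius unit_isNormaliser

end AlgebraData
end DaggerCompact

/-! ### Kraus maps and the positivity criterion. -/

namespace DaggerCompact
open DaggerCategory (dag)
open BraidedCategory

section
variable {V : Type u} [Category.{v} V] [MonoidalCategory V] [SymmetricCategory V]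

theorem braiding_middle (B P Q : V) :
    (β_ (P ⊗ Q) B).hom ≫ (α_ _ _ _).inv ≫ (β_ (B ⊗ P) Q).hom ≫ Q ◁ (β_ B P).hom =
      (β_ P Q).hom ▷ B ≫ (α_ _ _ _).hom := by
  rw [← braiding_naturality_left]
  simp only [braiding_tensor_left_hom, Category.assoc, Iso.hom_inv_id_assoc]
  rw [← comp_whiskerRight_assoc _ _ Q, SymmetricCategory.symmetry]
  simp only [id_whiskerRight, Category.id_comp, Iso.inv_hom_id_assoc]
  rw [← whiskerLeft_comp_assoc, SymmetricCategory.symmetry]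
  simp

theorem braiding_middle' (B P Q : V) :
    (β_ (B ⊗ P) Q).hom ≫ Q ◁ (β_ B P).hom ≫ (α_ _ _ _).inv ≫ (β_ Q P).hom ▷ B =
      (α_ _ _ _).hom ≫ (β_ B (P ⊗ Q)).hom := by
  rw [← braiding_naturality_left_assoc]
  simp only [braiding_tensor_left_hom, braiding_tensor_right_hom, Category.assoc,
    Iso.hom_inv_id_assoc]
  rw [← comp_whiskerRight, SymmetricCategory.symmetry]
  simp

/-- Braiding the two blocks past each other interchanges the inner and outer pairings of a nest. It
serves both the caps of a tensor product and the symmetry of `nestedForm`. -/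
theorem braiding_nested {X X' B B' : V} (a : X ⊗ X' ⟶ 𝟙_ V) (b : B ⊗ B' ⟶ 𝟙_ V) :
    (β_ (B' ⊗ X') (X ⊗ B)).hom ≫ 𝟙 _ ⊗≫ X ◁ b ▷ X' ⊗≫ a =
      (α_ _ _ _).hom ≫ B' ◁ ((α_ _ _ _).inv ≫ ((β_ X' X).hom ≫ a) ▷ B ≫ (λ_ B).hom) ≫
        (β_ B' B).hom ≫ b := by
  have hb : b ▷ X' = (β_ (B ⊗ B') X').hom ≫ X' ◁ b ≫ (ρ_ _).hom ≫ (λ_ _).inv := by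
    rw [← braiding_naturality_left_assoc]; simp
  have ha : B' ◁ ((β_ X' X).hom ≫ a) = (β_ B' (X' ⊗ X)).hom ≫ ((β_ X' X).hom ≫ a) ▷ B' ≫
      (λ_ _).hom ≫ (ρ_ _).inv := by
    rw [← braiding_naturality_right_assoc]; simp
  calc
    _ = (β_ (B' ⊗ X') (X ⊗ B)).hom ≫ 𝟙 _ ⊗≫ X ◁ (β_ (B ⊗ B') X').hom ⊗≫
          ((X ⊗ X') ◁ b ≫ a ▷ 𝟙_ V) ⊗≫ 𝟙 _ := by rw [hb]; monoidal
    _ = (α_ _ _ _).inv ≫ (β_ (B' ⊗ X') X).hom ▷ B ⊗≫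
         X ◁ ((β_ (B' ⊗ X') B).hom ≫ (α_ _ _ _).inv ≫ (β_ (B ⊗ B') X').hom ≫
           X' ◁ (β_ B B').hom ≫ X' ◁ (β_ B' B).hom) ⊗≫
          a ▷ (B ⊗ B') ⊗≫ b := by
      rw [whisker_exchange, ← whiskerLeft_comp X', SymmetricCategory.symmetry,
        braiding_tensor_right_hom]; monoidal
    _ = (α_ _ _ _).inv ≫ ((β_ (B' ⊗ X') X).hom ≫ X ◁ (β_ B' X').hom) ▷ B ⊗≫
          ((X ⊗ X') ◁ (β_ B' B).hom ≫ a ▷ (B ⊗ B')) ⊗≫ b := by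
      rw [reassoc_of% braiding_middle]; monoidal
    _ = (α_ _ _ _).inv ≫ ((β_ (B' ⊗ X') X).hom ≫ X ◁ (β_ B' X').hom) ▷ B ⊗≫
          ((β_ X X').hom ≫ (β_ X' X).hom) ▷ (B' ⊗ B) ⊗≫ a ▷ (B' ⊗ B) ⊗≫ (β_ B' B).hom ≫ b := by
      rw [whisker_exchange, SymmetricCategory.symmetry]; monoidal
    _ = (α_ _ _ _).inv ≫ ((α_ _ _ _).hom ≫ (β_ B' (X' ⊗ X)).hom) ▷ B ⊗≫
          ((β_ X' X).hom ≫ a) ▷ (B' ⊗ B) ⊗≫ (β_ B' B).hom ≫ b := by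
      rw [← braiding_middle']; monoidal
    _ = 𝟙 _ ⊗≫ (B' ◁ ((β_ X' X).hom ≫ a)) ▷ B ⊗≫ (β_ B' B).hom ≫ b := by rw [ha]; monoidal
    _ = _ := by monoidal

end

variable {V : Type u} [Category.{v} V] [MonoidalCategory V] [SymmetricCategory V]
  [DaggerCompactCategory V]

theorem dualTensorIso_inv_cap' (X B : V) :
    (dualTensorIso X B).inv ▷ (X ⊗ B) ≫ cap' (X ⊗ B) =
      (α_ _ _ _).hom ≫ dualObj B ◁ ((α_ _ _ _).inv ≫ cap' X ▷ B ≫ (λ_ B).hom) ≫ cap' B := by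
  rw [cap', braiding_naturality_left_assoc, dualTensorIso_inv_cap, braiding_nested]
  rfl

theorem transpose_cap' {A B : V} (f : A ⟶ B) :
    transpose f ▷ A ≫ cap' A = dualObj B ◁ f ≫ cap' B := by
  rw [cap', braiding_naturality_left_assoc, leftAdjointMate_comp_evaluation,
    ← braiding_naturality_right_assoc, cap']

/-- The conjugate of `g : A ⟶ X ⊗ B`, with its `X`-wire connected to an input by a cap. -/
def conjContract {A B X : V} (g : A ⟶ X ⊗ B) : dualObj A ⊗ X ⟶ dualObj B :=
  (conj g ≫ (dualTensorIso X B).hom) ▷ X ≫ (α_ _ _ _).hom ≫ dualObj B ◁ cap' X ≫ (ρ_ _).hom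

/-- The conjugate is the transpose of the dagger, so closing off its output wires leaves only `g†`.
This removes the dual of `X` from the Kraus double. -/
theorem conjContract_cap' {A B X : V} (g : A ⟶ X ⊗ B) :
    conjContract g ▷ B ≫ cap' B = (α_ _ _ _).hom ≫ dualObj A ◁ dag g ≫ cap' A := by
  calc
    _ = (α_ _ _ _).hom ≫ (conj g ≫ (dualTensorIso X B).hom) ▷ (X ⊗ B) ≫ (α_ _ _ _).hom ≫
        dualObj B ◁ ((α_ _ _ _).inv ≫ cap' X ▷ B ≫ (λ_ B).hom) ≫ cap' B := by
      rw [conjContract]; monoidal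
    _ = (α_ _ _ _).hom ≫ conj g ▷ (X ⊗ B) ≫ cap' _ := by
      rw [← dualTensorIso_inv_cap', ← comp_whiskerRight_assoc, Category.assoc, Iso.hom_inv_id,
        Category.comp_id]
    _ = _ := by rw [conj, transpose_cap']

theorem krausDouble_eq {A B X : V} (g : A ⟶ X ⊗ B) :
    krausDouble g = dualObj A ◁ g ≫ (α_ _ _ _).inv ≫ conjContract g ▷ B := by
  rw [krausDouble, MonoidalCategory.tensorHom_def', conjContract]
  monoidal

namespace AlgebraData

/-- The map `A ⊗ B ⟶ A ⊗ B` whose positivity characterises the maps `f : A ⟶ B` satisfying the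
CP*-condition. -/
def choi (A B : AlgebraData V) (f : A.carrier ⟶ B.carrier) :
    A.carrier ⊗ B.carrier ⟶ A.carrier ⊗ B.carrier :=
  A.comul ▷ B.carrier ≫ (α_ _ _ _).hom ≫ A.carrier ◁ (f ▷ B.carrier ≫ B.mul)

/-- The Kraus map obtained from `h : A ⊗ B ⟶ X` by bending the wire `B`. -/
def bendKraus {A X : V} (B : AlgebraData V) (h : A ⊗ B.carrier ⟶ X) : A ⟶ X ⊗ B.carrier :=
  (ρ_ A).inv ≫ A ◁ B.casimir ≫ (α_ _ _ _).inv ≫ h ▷ B.carrier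

/-- The map `A* ⊗ A ⟶ B* ⊗ B` obtained from `p : A ⊗ B ⟶ A ⊗ B` by bending wires. -/
def bend {A : V} (B : AlgebraData V) (p : A ⊗ B.carrier ⟶ A ⊗ B.carrier) :
    dualObj A ⊗ A ⟶ dualObj B.carrier ⊗ B.carrier :=
  dualObj A ◁ B.bendKraus p ≫ (α_ _ _ _).inv ≫
    ((α_ _ _ _).inv ≫ cap' A ▷ B.carrier ≫ (λ_ _).hom ≫ B.toDual) ▷ B.carrier

variable {B : AlgebraData V}

/-- The copy of the Kraus map on `A` contributes `h` and the conjugate copy contributes `h†`;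
contracting the `X`-wires composes them. -/
theorem bend_comp_dag (hB : B.IsNormalisableDaggerFrobenius) {A X : V} (h : A ⊗ B.carrier ⟶ X) :
    krausDouble (B.bendKraus h) = B.bend (h ≫ dag h) := by
  have hF := hB.isDaggerFrobenius
  -- The dagger of the copairing in `bendKraus` is the form, which `toDual` followed by `cap'`
  -- reproduces.
  have key : conjContract (B.bendKraus h) = dualObj A ◁ dag h ≫ (α_ _ _ _).inv ≫
      cap' A ▷ B.carrier ≫ (λ_ _).hom ≫ B.toDual := by
    apply eq_of_whiskerRight_cap'
    have hd : dag (B.bendKraus h) = dag h ▷ B.carrier ≫ (α_ _ _ _).hom ≫ A ◁ B.form ≫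
        (ρ_ _).hom := by simp [bendKraus]
    rw [conjContract_cap', hd]
    simp only [comp_whiskerRight, Category.assoc]
    rw [hB.toDual_cap']
    calc
      _ = 𝟙 _ ⊗≫ (dualObj A ◁ dag h) ▷ B.carrier ⊗≫ ((dualObj A ⊗ A) ◁ B.form ≫
        cap' A ▷ 𝟙_ V) ⊗≫ 𝟙 _ := by monoidal
      _ = _ := by rw [whisker_exchange]; monoidal
  rw [krausDouble_eq, key, bend, bendKraus, bendKraus]
  monoidal

/-- The copairing fed into the product of `B` becomes its comultiplication, and `toDual` on one leg
of that is the action. The cap on `A` meets the comultiplication of `A` to form the coaction. -/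
theorem bend_choi {A : AlgebraData V} (hB : B.IsNormalisableDaggerFrobenius)
    (f : A.carrier ⟶ B.carrier) : B.bend (A.choi B f) = A.coaction ≫ f ≫ B.action := by
  have hF := hB.isDaggerFrobenius
  rw [hF.action_eq, ← hF.comul_eq_right]
  calc
    _ = 𝟙 _ ⊗≫ dualObj A.carrier ◁ (A.carrier ◁ B.casimir ≫ A.comul ▷ (B.carrier ⊗ B.carrier)) ⊗≫
          ((dualObj A.carrier ⊗ A.carrier) ◁ (f ▷ B.carrier ≫ B.mul) ≫
            cap' A.carrier ▷ B.carrier) ▷ B.carrier ⊗≫ B.toDual ▷ B.carrier := by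
      rw [bend, bendKraus, choi]; monoidal
    _ = 𝟙 _ ⊗≫ dualObj A.carrier ◁ (A.comul ▷ 𝟙_ V ≫ (A.carrier ⊗ A.carrier) ◁ B.casimir) ⊗≫
          (cap' A.carrier ▷ (A.carrier ⊗ B.carrier) ≫ 𝟙_ V ◁ (f ▷ B.carrier ≫ B.mul)) ▷
            B.carrier ⊗≫ B.toDual ▷ B.carrier := by
      rw [whisker_exchange, whisker_exchange]
    _ = 𝟙 _ ⊗≫ dualObj A.carrier ◁ A.comul ⊗≫
          ((dualObj A.carrier ⊗ A.carrier) ◁ (A.carrier ◁ B.casimir) ≫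
            cap' A.carrier ▷ (A.carrier ⊗ B.carrier ⊗ B.carrier)) ⊗≫
          f ▷ B.carrier ▷ B.carrier ⊗≫ B.mul ▷ B.carrier ⊗≫ B.toDual ▷ B.carrier := by
      monoidal
    _ = 𝟙 _ ⊗≫ dualObj A.carrier ◁ A.comul ⊗≫ cap' A.carrier ▷ A.carrier ⊗≫
          (A.carrier ◁ B.casimir ≫ f ▷ (B.carrier ⊗ B.carrier)) ⊗≫ B.mul ▷ B.carrier
         ⊗≫ B.toDual ▷ B.carrier := by
      rw [whisker_exchange]; monoidal
    _ = _ := by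
      rw [whisker_exchange, coaction]; monoidal

theorem exists_bendKraus_eq (hB : B.IsDaggerFrobenius) {A X : V}
    (g : A ⟶ X ⊗ B.carrier) : ∃ h : A ⊗ B.carrier ⟶ X, B.bendKraus h = g := by
  refine ⟨g ▷ B.carrier ≫ (α_ _ _ _).hom ≫ X ◁ B.form ≫ (ρ_ _).hom, ?_⟩
  calc
    _ = 𝟙 _ ⊗≫ (A ◁ B.casimir ≫ g ▷ (B.carrier ⊗ B.carrier)) ⊗≫
        X ◁ B.form ▷ B.carrier ⊗≫ 𝟙 _ := by
      rw [bendKraus]; monoidal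
    _ = g ≫ X ◁ ((ρ_ B.carrier).inv ≫ B.carrier ◁ B.casimir ≫
        (α_ B.carrier B.carrier B.carrier).inv ≫ B.form ▷ B.carrier ≫ (λ_ _).hom) := by
      rw [whisker_exchange]; monoidal
    _ = _ := by rw [hB.form_casimir]; simp

theorem bendKraus_injective (hB : B.IsDaggerFrobenius) {A X : V}
    {h k : A ⊗ B.carrier ⟶ X} (e : B.bendKraus h = B.bendKraus k) : h = k := by
  have key : ∀ h : A ⊗ B.carrier ⟶ X,
      B.bendKraus h ▷ B.carrier ≫ (α_ _ _ _).hom ≫ X ◁ B.form ≫ (ρ_ _).hom = h := fun h => by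
    calc
      _ = 𝟙 _ ⊗≫ A ◁ B.casimir ▷ B.carrier ⊗≫ (h ▷ (B.carrier ⊗ B.carrier) ≫ X ◁ B.form)
          ⊗≫ 𝟙 _ := by
        rw [bendKraus]; monoidal
      _ = A ◁ ((λ_ B.carrier).inv ≫ B.casimir ▷ B.carrier ≫
          (α_ B.carrier B.carrier B.carrier).hom ≫ B.carrier ◁ B.form ≫ (ρ_ _).hom) ≫ h := by
        rw [← whisker_exchange]; monoidal
      _ = _ := by rw [hB.casimir_form]; simp
  rw [← key h, e, key k]

theorem bend_injective (hB : B.IsNormalisableDaggerFrobenius) {A : V}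
    {p q : A ⊗ B.carrier ⟶ A ⊗ B.carrier} (h : B.bend p = B.bend q) : p = q := by
  -- Undo `bend`: unitarity removes `toDual`, and a cup on `A` straightens the cap.
  have key : ∀ p : A ⊗ B.carrier ⟶ A ⊗ B.carrier,
      (λ_ A).inv ≫ cup' A ▷ A ≫ (α_ _ _ _).hom ≫ A ◁ (B.bend p ≫ dag B.toDual ▷ B.carrier) ≫
        (α_ _ _ _).inv = B.bendKraus p := fun p => by
    have e : B.bend p ≫ dag B.toDual ▷ B.carrier = dualObj A ◁ B.bendKraus p ≫ (α_ _ _ _).inv ≫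
        ((α_ _ _ _).inv ≫ cap' A ▷ B.carrier ≫ (λ_ _).hom) ▷ B.carrier := by
      simp only [bend, Category.assoc, ← comp_whiskerRight, hB.toDual_dag, Category.comp_id]
    rw [e]
    calc
      _ = 𝟙 _ ⊗≫ (cup' A ▷ A ≫ (A ⊗ dualObj A) ◁ B.bendKraus p) ⊗≫
          A ◁ cap' A ▷ (B.carrier ⊗ B.carrier) ⊗≫ 𝟙 _ := by monoidal
      _ = 𝟙 _ ⊗≫ B.bendKraus p ⊗≫ (cup' A ▷ A ≫ (α_ _ _ _).hom ≫ A ◁ cap' A) ▷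
          (B.carrier ⊗ B.carrier) ⊗≫ 𝟙 _ := by
        rw [← whisker_exchange]; monoidal
      _ = _ := by rw [cup'_cap']; monoidal
  exact bendKraus_injective hB.isDaggerFrobenius (by rw [← key p, h, key q])

theorem cpStarCondition_iff {A : AlgebraData V} (hB : B.IsNormalisableDaggerFrobenius)
    (f : A.carrier ⟶ B.carrier) : CPStarCondition A B f ↔ IsPositive (A.choi B f) := by
  constructor
  · rintro ⟨X, g, hg⟩
    obtain ⟨h, rfl⟩ := exists_bendKraus_eq hB.isDaggerFrobenius g
    exact ⟨X, h, bend_injective hB (by rw [bend_choi hB, hg, bend_comp_dag hB])⟩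
  · rintro ⟨X, h, hh⟩
    exact ⟨X, B.bendKraus h, by rw [bend_comp_dag hB, ← hh, bend_choi hB]⟩

end AlgebraData
end DaggerCompact

/-! ### Transposition of positive maps, and Choi maps of tensor products and composites. -/

namespace DaggerCompact
open DaggerCategory (dag)
open BraidedCategory

variable {V : Type u} [Category.{v} V] [MonoidalCategory V] [SymmetricCategory V]

theorem tensorδ_whiskerRight (X₁ X₂ Y₁ Y₂ Z₁ Z₂ : V) :
    tensorδ X₁ X₂ Y₁ Y₂ ▷ (Z₁ ⊗ Z₂) ≫ (α_ _ _ _).hom ≫ (X₁ ⊗ X₂) ◁ tensorμ Y₁ Y₂ Z₁ Z₂ =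
      tensorμ (X₁ ⊗ Y₁) (X₂ ⊗ Y₂) Z₁ Z₂ ≫ ((α_ _ _ _).hom ⊗ₘ (α_ _ _ _).hom) ≫
        tensorδ X₁ X₂ (Y₁ ⊗ Z₁) (Y₂ ⊗ Z₂) := by
  have h := congrArg (fun t => tensorδ X₁ X₂ Y₁ Y₂ ▷ (Z₁ ⊗ Z₂) ≫ t ≫
    tensorδ X₁ X₂ (Y₁ ⊗ Z₁) (Y₂ ⊗ Z₂)) (tensor_associativity X₁ X₂ Y₁ Y₂ Z₁ Z₂)
  simp only [Category.assoc, ← comp_whiskerRight_assoc, tensorδ_tensorμ,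
    id_whiskerRight, Category.id_comp, tensorμ_tensorδ, Category.comp_id] at h
  exact h.symm

theorem tensorδ_natural_right (Z₁ Z₂ : V) {X₁ X₂ Y₁ Y₂ : V} (f₁ : X₁ ⟶ Y₁) (f₂ : X₂ ⟶ Y₂) :
    tensorδ Z₁ Z₂ X₁ X₂ ≫ (Z₁ ⊗ Z₂) ◁ (f₁ ⊗ₘ f₂) =
      (Z₁ ◁ f₁ ⊗ₘ Z₂ ◁ f₂) ≫ tensorδ Z₁ Z₂ Y₁ Y₂ := by
  rw [← cancel_mono (tensorμ Z₁ Z₂ Y₁ Y₂), Category.assoc, tensorμ_natural_right,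
    tensorδ_tensorμ_assoc, Category.assoc, tensorδ_tensorμ, Category.comp_id]

variable [DaggerCompactCategory V]

/-- The transpose of a positive map across a symmetric pair of nondegenerate pairings is
positive. -/
theorem IsPositive.of_pairing {P Q : V} {M : Q ⊗ P ⟶ 𝟙_ V} {M' : P ⊗ Q ⟶ 𝟙_ V}
    (hM : (β_ P Q).hom ≫ M = M')
    (hs : (λ_ P).inv ≫ dag M' ▷ P ≫ (α_ _ _ _).hom ≫ P ◁ M ≫ (ρ_ P).hom = 𝟙 P)
    {p : Q ⟶ Q} (hp : IsPositive p) {r : P ⟶ P} (hr : Q ◁ r ≫ M = p ▷ P ≫ M) :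
    IsPositive r := by
  obtain ⟨X, h, rfl⟩ := hp
  have hk := curryCap_cap (dag h ▷ P ≫ M)
  set k := curryCap (dag h ▷ P ≫ M)
  -- The copairing is the dagger of the pairing, so the `k` that transposes `h†` across `M` also
  -- describes `h` across the copairing. This is what makes the transpose `k† ∘ k`.
  have hn : dag M' ≫ P ◁ h = cup X ≫ dag k ▷ X := by
    apply dag_injective
    simp only [DaggerCategory.dag_comp, DaggerCategory.dag_dag, dag_whiskerLeft,
      dag_whiskerRight, dag_cup]
    rw [cap', braiding_naturality_left_assoc, hk, ← hM, braiding_naturality_right_assoc]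
  refine ⟨_, k, ?_⟩
  calc
    r = r ≫ (λ_ P).inv ≫ dag M' ▷ P ≫ (α_ _ _ _).hom ≫ P ◁ M ≫ (ρ_ P).hom := by
      rw [hs, Category.comp_id]
    _ = 𝟙 _ ⊗≫ (𝟙_ V ◁ r ≫ dag M' ▷ P) ⊗≫ P ◁ M ⊗≫ 𝟙 _ := by monoidal
    _ = 𝟙 _ ⊗≫ dag M' ▷ P ⊗≫ P ◁ (Q ◁ r ≫ M) ⊗≫ 𝟙 _ := by rw [whisker_exchange]; monoidal
    _ = 𝟙 _ ⊗≫ (dag M' ≫ P ◁ h) ▷ P ⊗≫ P ◁ (dag h ▷ P ≫ M) ⊗≫ 𝟙 _ := by rw [hr]; monoidal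
    _ = 𝟙 _ ⊗≫ cup X ▷ P ⊗≫ (dag k ▷ (X ⊗ P) ≫ P ◁ (X ◁ k ≫ cap X)) ⊗≫ 𝟙 _ := by
      rw [hn, hk]; monoidal
    _ = 𝟙 _ ⊗≫ (cup X ▷ P ≫ (dualObj X ⊗ X) ◁ k) ⊗≫ dualObj X ◁ cap X ⊗≫ dag k ⊗≫ 𝟙 _ := by
      rw [← whisker_exchange]; monoidal
    _ = k ⊗≫ (cup X ▷ dualObj X ⊗≫ dualObj X ◁ cap X) ⊗≫ dag k := by
      rw [← whisker_exchange]; monoidal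
    _ = _ := by
      rw [ExactPairing.evaluation_coevaluation'']
      monoidal

namespace AlgebraData

theorem choi_id {A : AlgebraData V} (hA : A.IsDaggerFrobenius) :
    A.choi A (𝟙 _) = A.mul ≫ dag A.mul := by
  rw [choi, id_whiskerRight, Category.id_comp, hA.frobenius_right, dag_mul]

theorem IsUnitaryHom.choi_eq {A B : AlgebraData V} {e : A.carrier ⟶ B.carrier}
    (he : IsUnitaryHom A B e) :
    A.choi B e = e ▷ B.carrier ≫ B.choi B (𝟙 _) ≫ dag (e ▷ B.carrier) := by
  calc
    _ = A.comul ▷ B.carrier ≫ (α_ _ _ _).hom ≫ (e ≫ dag e) ▷ _ ≫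
        A.carrier ◁ (e ▷ B.carrier ≫ B.mul) := by
      rw [he.hom_dag, choi]; simp
    _ = 𝟙 _ ⊗≫ (A.comul ≫ (e ⊗ₘ e)) ▷ B.carrier ⊗≫ (dag e ▷ (B.carrier ⊗ B.carrier) ≫
        A.carrier ◁ B.mul) ⊗≫ 𝟙 _ := by
      calc
        _ = 𝟙 _ ⊗≫ A.comul ▷ B.carrier ⊗≫ e ▷ (A.carrier ⊗ B.carrier) ≫
            (dag e ▷ (A.carrier ⊗ B.carrier) ≫ A.carrier ◁ (e ▷ B.carrier)) ≫
              A.carrier ◁ B.mul := by monoidal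
        _ = _ := by rw [← whisker_exchange, MonoidalCategory.tensorHom_def]; monoidal
    _ = _ := by
      rw [← whisker_exchange, ← he.comul_hom, choi, dag_whiskerRight]
      monoidal

theorem choi_tensor (A B A' B' : AlgebraData V) (f : A.carrier ⟶ B.carrier)
    (f' : A'.carrier ⟶ B'.carrier) :
    (A.tensor A').choi (B.tensor B') (f ⊗ₘ f') =
      tensorμ _ _ _ _ ≫ (A.choi B f ⊗ₘ A'.choi B' f') ≫ dag (tensorμ _ _ _ _) := by
  have hd : dag (tensorμ A.carrier A'.carrier A.carrier A'.carrier ≫ (A.mul ⊗ₘ A'.mul)) =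
    (A.comul ⊗ₘ A'.comul) ≫ tensorδ A.carrier A'.carrier A.carrier A'.carrier := tensor_comul A A'
  change dag (tensorμ A.carrier A'.carrier A.carrier A'.carrier ≫ (A.mul ⊗ₘ A'.mul)) ▷
    (B.carrier ⊗ B'.carrier) ≫ (α_ _ _ _).hom ≫ (A.carrier ⊗ A'.carrier) ◁
      ((f ⊗ₘ f') ▷ (B.carrier ⊗ B'.carrier) ≫
        tensorμ B.carrier B'.carrier B.carrier B'.carrier ≫ (B.mul ⊗ₘ B'.mul)) = _
  rw [hd, tensorμ_natural_left_assoc, whiskerLeft_comp, comp_whiskerRight_assoc,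
    reassoc_of% tensorδ_whiskerRight, tensorμ_natural_left_assoc, tensorHom_comp_tensorHom,
    tensorδ_natural_right, tensorHom_comp_tensorHom_assoc, tensorHom_comp_tensorHom_assoc,
    dag_tensorμ, tensorδ_eq_tensorμ, choi, choi]
  simp only [Category.assoc]

/-- Associativity reduces `μ ∘ μ†` to multiplication by the product of the copairing, an element
that `z²` normalises to the unit. -/
theorem IsNormalisableDaggerFrobenius.comul_mul {A : AlgebraData V}
    (hA : A.IsNormalisableDaggerFrobenius) :
    A.comul ≫ (A.normaliser ≫ A.normaliser) ▷ A.carrier ≫ A.mul = 𝟙 _ := by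
  have h := hA.isNormaliser.normalised
  rw [reassoc_of% hA.casimir_braiding] at h
  have hz : (A.normaliser ≫ A.normaliser) ▷ A.carrier ≫ A.mul =
      A.mul ≫ A.normaliser ≫ A.normaliser := by
    rw [comp_whiskerRight_assoc, hA.central_left, reassoc_of% hA.central_left]
  calc
    _ = A.comul ≫ A.mul ≫ A.normaliser ≫ A.normaliser := by rw [hz]
    _ = (λ_ _).inv ≫ A.casimir ▷ A.carrier ≫ (A.mul ▷ A.carrier ≫ A.mul) ≫ A.normaliser ≫
          A.normaliser := by
      rw [hA.mul_assoc, ← hA.isDaggerFrobenius.comul_eq_left]; simp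
    _ = (λ_ _).inv ≫ (A.casimir ≫ A.mul ≫ A.normaliser ≫ A.normaliser) ▷ A.carrier ≫ A.mul := by
      simp only [comp_whiskerRight, Category.assoc]
      rw [hA.central_left, reassoc_of% hA.central_left]
    _ = _ := by rw [h, hA.one_mul, Iso.inv_hom_id]

/-- The pairing of `casimir` with both of its legs twisted by the normaliser. -/
theorem IsNormalisableDaggerFrobenius.twisted_snake {B : AlgebraData V}
    (hB : B.IsNormalisableDaggerFrobenius) :
    (ρ_ B.carrier).inv ≫ B.carrier ◁ (B.casimir ≫ B.normaliser ▷ B.carrier) ≫ (α_ _ _ _).inv ≫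
      B.mul ▷ B.carrier ≫ B.carrier ◁ B.comul ≫ (α_ _ _ _).inv ≫
        (B.normaliser ▷ B.carrier ≫ B.form) ▷ B.carrier ≫ (λ_ _).hom = 𝟙 _ := by
  have hF := hB.isDaggerFrobenius
  calc
    _ = 𝟙 _ ⊗≫ B.carrier ◁ B.casimir ⊗≫ (B.carrier ◁ B.normaliser ≫ B.mul) ▷ B.carrier ≫
        (B.carrier ◁ B.comul ≫ B.normaliser ▷ (B.carrier ⊗ B.carrier)) ⊗≫
        B.form ▷ B.carrier ⊗≫ 𝟙 _ := by monoidal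
    _ = ((ρ_ B.carrier).inv ≫ B.carrier ◁ B.casimir ≫ (α_ _ _ _).inv ≫ B.mul ▷ B.carrier) ≫
        (B.normaliser ≫ B.normaliser) ▷ B.carrier ≫
        (B.carrier ◁ B.comul ≫ (α_ _ _ _).inv ≫ B.mul ▷ B.carrier) ≫ B.counit ▷ B.carrier ≫
        (λ_ _).hom := by
      rw [hB.central_right, whisker_exchange, form]; monoidal
    _ = _ := by
      rw [hF.comul_eq_right, hF.frobenius_left, Category.assoc, reassoc_of% hF.comul_counit_left,
        Iso.inv_hom_id, Category.comp_id, hB.comul_mul]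

/-- Joining the two Choi maps through `B` leaves a loop `μ ∘ μ†`. One `z` comes from the conjugating
map and one from its dagger, as `z` is self-adjoint, and `twisted_snake` cancels the loop. -/
theorem choi_comp {A B C : AlgebraData V} (hB : B.IsNormalisableDaggerFrobenius)
    (f : A.carrier ⟶ B.carrier) (g : B.carrier ⟶ C.carrier) :
    A.choi C (f ≫ g) =
      (A.carrier ◁ ((λ_ _).inv ≫ (B.casimir ≫ B.normaliser ▷ B.carrier) ▷ C.carrier ≫
        (α_ _ _ _).hom) ≫ (α_ _ _ _).inv) ≫ (A.choi B f ⊗ₘ B.choi C g) ≫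
      dag (A.carrier ◁ ((λ_ _).inv ≫ (B.casimir ≫ B.normaliser ▷ B.carrier) ▷ C.carrier ≫
        (α_ _ _ _).hom) ≫ (α_ _ _ _).inv) := by
  have hz : dag B.normaliser = B.normaliser := hB.posDef.1.dag_eq
  simp only [DaggerCategory.dag_comp, dag_whiskerLeft, dag_whiskerRight, dag_casimir,
    dag_associator_inv, DaggerCompactCategory.dag_associator, dag_leftUnitor_inv, hz]
  symm
  calc
    _ = 𝟙 _ ⊗≫ (A.carrier ◁ (B.casimir ≫ B.normaliser ▷ B.carrier) ≫
          A.comul ▷ (B.carrier ⊗ B.carrier)) ▷ C.carrier ⊗≫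
        A.carrier ◁ (f ▷ B.carrier ≫ B.mul) ▷ B.carrier ▷ C.carrier ⊗≫
        A.carrier ◁ B.carrier ◁ B.comul ▷ C.carrier ⊗≫
        A.carrier ◁ ((B.carrier ⊗ B.carrier) ◁ (g ▷ C.carrier ≫ C.mul) ≫
          (B.normaliser ▷ B.carrier ≫ B.form) ▷ C.carrier) ⊗≫ 𝟙 _ := by
      rw [MonoidalCategory.tensorHom_def, choi, choi]; monoidal
    _ = 𝟙 _ ⊗≫ A.comul ▷ C.carrier ⊗≫
        A.carrier ◁ (A.carrier ◁ (B.casimir ≫ B.normaliser ▷ B.carrier) ≫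
          f ▷ (B.carrier ⊗ B.carrier)) ▷ C.carrier ⊗≫
        A.carrier ◁ B.mul ▷ B.carrier ▷ C.carrier ⊗≫
        A.carrier ◁ B.carrier ◁ B.comul ▷ C.carrier ⊗≫
        A.carrier ◁ (B.normaliser ▷ B.carrier ≫ B.form) ▷ (B.carrier ⊗ C.carrier) ⊗≫
        A.carrier ◁ (g ▷ C.carrier ≫ C.mul) := by
      rw [whisker_exchange, whisker_exchange]; monoidal
    _ = A.comul ▷ C.carrier ≫ (α_ _ _ _).hom ≫ A.carrier ◁ (f ≫
        ((ρ_ B.carrier).inv ≫ B.carrier ◁ (B.casimir ≫ B.normaliser ▷ B.carrier) ≫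
          (α_ _ _ _).inv ≫ B.mul ▷ B.carrier ≫ B.carrier ◁ B.comul ≫ (α_ _ _ _).inv ≫
        (B.normaliser ▷ B.carrier ≫ B.form) ▷ B.carrier ≫ (λ_ _).hom)) ▷ C.carrier ≫
        A.carrier ◁ (g ▷ C.carrier ≫ C.mul) := by
      rw [whisker_exchange]; monoidal
    _ = _ := by
      rw [hB.twisted_snake, choi]; simp

/-- The opposite product sends one leg of the copairing to the right of the first input, the other
to the left of the second; by the Frobenius law this is `μ† ∘ μ`. -/
theorem casimir_tensor_mul (A : AlgebraData V) (hA : A.IsDaggerFrobenius) :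
    (λ_ _).inv ≫ A.casimir ▷ (A.carrier ⊗ A.carrier) ≫ (A.op.tensor A).mul =
      A.mul ≫ dag A.mul := by
  calc
    _ = 𝟙 _ ⊗≫ (A.casimir ▷ A.carrier ≫ (β_ (A.carrier ⊗ A.carrier) A.carrier).hom) ▷ A.carrier
        ⊗≫ (A.mul ⊗ₘ A.mul) := by
      simp only [tensor, op, tensorμ, braiding_tensor_left_hom, MonoidalCategory.tensorHom_def]
      monoidal
    _ = _ := by
      rw [braiding_naturality_left, braiding_tensorUnit_left, dag_mul, ← hA.frobenius_right,
        ← hA.comul_eq_right, MonoidalCategory.tensorHom_def]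
      monoidal

end AlgebraData
end DaggerCompact

/-! ### Closure under dagger, cups and coherence isomorphisms. -/

namespace DaggerCompact
open DaggerCategory (dag)
open BraidedCategory

variable {V : Type u} [Category.{v} V] [MonoidalCategory V] [SymmetricCategory V]
  [DaggerCompactCategory V]

namespace AlgebraData

/-- The nested pairing of `A ⊗ B` with `B ⊗ A`. -/
def nestedForm (A B : AlgebraData V) :
    (A.carrier ⊗ B.carrier) ⊗ (B.carrier ⊗ A.carrier) ⟶ 𝟙_ V :=
  (α_ _ _ _).hom ≫ A.carrier ◁ ((α_ _ _ _).inv ≫ B.form ▷ A.carrier ≫ (λ_ _).hom) ≫ A.form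

theorem braiding_nestedForm {A B : AlgebraData V} (hA : A.IsNormalisableDaggerFrobenius)
    (hB : B.IsNormalisableDaggerFrobenius) :
    (β_ (B.carrier ⊗ A.carrier) (A.carrier ⊗ B.carrier)).hom ≫ A.nestedForm B =
      B.nestedForm A := by
  have h := braiding_nested A.form B.form
  rw [hA.braiding_form, hB.braiding_form] at h
  rw [nestedForm, nestedForm, ← h]
  monoidal

theorem nestedForm_snake {A B : AlgebraData V} (hA : A.IsDaggerFrobenius)
    (hB : B.IsDaggerFrobenius) :
    (λ_ _).inv ≫ dag (B.nestedForm A) ▷ (B.carrier ⊗ A.carrier) ≫ (α_ _ _ _).hom ≫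
      (B.carrier ⊗ A.carrier) ◁ A.nestedForm B ≫ (ρ_ _).hom = 𝟙 _ := by
  simp only [nestedForm, DaggerCategory.dag_comp, dag_whiskerLeft, dag_whiskerRight, dag_form,
    dag_associator_inv, DaggerCompactCategory.dag_associator, DaggerCompactCategory.dag_leftUnitor]
  calc
    _ = 𝟙 _ ⊗≫ B.casimir ▷ (B.carrier ⊗ A.carrier) ⊗≫
        B.carrier ◁ (A.casimir ▷ (B.carrier ⊗ B.carrier) ≫ (A.carrier ⊗ A.carrier) ◁ B.form) ▷
          A.carrier ⊗≫ B.carrier ◁ A.carrier ◁ A.form ⊗≫ 𝟙 _ := by monoidal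
    _ = ((λ_ B.carrier).inv ≫ B.casimir ▷ B.carrier ≫
    (α_ B.carrier B.carrier B.carrier).hom ≫ B.carrier ◁ B.form ≫ (ρ_ _).hom) ▷ A.carrier ≫
       B.carrier ◁ ((λ_ A.carrier).inv ≫ A.casimir ▷ A.carrier ≫
    (α_ A.carrier A.carrier A.carrier).hom ≫ A.carrier ◁ A.form ≫ (ρ_ _).hom) := by
      rw [← whisker_exchange]; monoidal
    _ = _ := by rw [hB.casimir_form, hA.casimir_form]; simp

theorem comul_form_right {A : AlgebraData V} (hA : A.IsDaggerFrobenius) :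
    A.carrier ◁ A.comul ≫ (α_ _ _ _).inv ≫ A.form ▷ A.carrier ≫ (λ_ _).hom = A.mul := by
  rw [form, comp_whiskerRight_assoc, reassoc_of% hA.frobenius_left,
    reassoc_of% hA.comul_counit_left, Iso.inv_hom_id, Category.comp_id]

theorem choi_dag_nestedForm {A B : AlgebraData V} (hA : A.IsDaggerFrobenius)
    (hB : B.IsDaggerFrobenius) (f : A.carrier ⟶ B.carrier) :
    (A.carrier ⊗ B.carrier) ◁ B.choi A (dag f) ≫ A.nestedForm B =
      dag (A.choi B f) ▷ (B.carrier ⊗ A.carrier) ≫ A.nestedForm B := by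
  -- Both sides send `a ⊗ b ⊗ b' ⊗ a'` to the form of `a` with `f†(b b') a'`.
  trans 𝟙 _ ⊗≫ A.carrier ◁ (B.mul ≫ dag f) ▷ A.carrier ⊗≫ A.carrier ◁ A.mul ≫ A.form
  · calc
      _ = 𝟙 _ ⊗≫ A.carrier ◁ B.carrier ◁ B.comul ▷ A.carrier ⊗≫
          A.carrier ◁ ((B.carrier ⊗ B.carrier) ◁ (dag f ▷ A.carrier ≫ A.mul) ≫
            B.form ▷ A.carrier) ⊗≫ A.form := by
        rw [choi, nestedForm]; monoidal
      _ = 𝟙 _ ⊗≫ A.carrier ◁ (B.carrier ◁ B.comul ≫ (α_ _ _ _).inv ≫ B.form ▷ B.carrier ≫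
          (λ_ _).hom) ▷ A.carrier ⊗≫ A.carrier ◁ (dag f ▷ A.carrier ≫ A.mul) ≫ A.form := by
        rw [whisker_exchange]; monoidal
      _ = _ := by rw [comul_form_right hB]; monoidal
  · symm
    have hd : dag (A.choi B f) = A.carrier ◁ (B.comul ≫ dag f ▷ B.carrier) ≫ (α_ _ _ _).inv ≫
        A.mul ▷ B.carrier := by simp [choi]
    rw [hd]
    calc
      _ = 𝟙 _ ⊗≫ A.carrier ◁ (B.comul ≫ dag f ▷ B.carrier) ▷ (B.carrier ⊗ A.carrier) ⊗≫
          (A.mul ▷ (B.carrier ⊗ B.carrier) ≫ A.carrier ◁ B.form) ▷ A.carrier ⊗≫ A.form := by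
        rw [nestedForm]; monoidal
      _ = 𝟙 _ ⊗≫ A.carrier ◁ (B.comul ▷ B.carrier ⊗≫ (dag f ▷ (B.carrier ⊗ B.carrier) ≫
            A.carrier ◁ B.form)) ▷ A.carrier ⊗≫ A.mul ▷ A.carrier ≫ A.form := by
        rw [← whisker_exchange]; monoidal
      _ = 𝟙 _ ⊗≫ A.carrier ◁ ((B.comul ▷ B.carrier ≫ (α_ _ _ _).hom ≫ B.carrier ◁ B.form ≫
            (ρ_ _).hom) ≫ dag f) ▷ A.carrier ⊗≫ A.mul ▷ A.carrier ≫ A.form := by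
        rw [← whisker_exchange]; monoidal
      _ = _ := by rw [hB.comul_form, hA.mul_form]; monoidal

theorem isPositive_choi_dag {A B : AlgebraData V} (hA : A.IsNormalisableDaggerFrobenius)
    (hB : B.IsNormalisableDaggerFrobenius) {f : A.carrier ⟶ B.carrier}
    (hf : IsPositive (A.choi B f)) : IsPositive (B.choi A (dag f)) := by
  refine hf.of_pairing (braiding_nestedForm hA hB)
    (nestedForm_snake hA.isDaggerFrobenius hB.isDaggerFrobenius) ?_
  rw [choi_dag_nestedForm hA.isDaggerFrobenius hB.isDaggerFrobenius, hf.dag_eq]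

/-- For a state the Choi map is left multiplication by it, up to conjugation by a unitor. -/
theorem choi_unit (B : AlgebraData V) (ψ : 𝟙_ V ⟶ B.carrier) :
    (unit V).choi B ψ = (λ_ B.carrier).hom ≫ ((λ_ B.carrier).inv ≫ ψ ▷ B.carrier ≫ B.mul) ≫
      dag (λ_ B.carrier).hom := by
  change dag (ρ_ (𝟙_ V)).hom ▷ B.carrier ≫ (α_ _ _ _).hom ≫
    𝟙_ V ◁ (ψ ▷ B.carrier ≫ B.mul) = _
  rw [DaggerCompactCategory.dag_rightUnitor, DaggerCompactCategory.dag_leftUnitor]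
  monoidal

section CPStarCondition

variable {A B C A' B' : AlgebraData V}

theorem cpStarCondition_id (hA : A.IsNormalisableDaggerFrobenius) :
    CPStarCondition A A (𝟙 A.carrier) :=
  (cpStarCondition_iff hA _).2 ⟨_, A.mul, choi_id hA.isDaggerFrobenius⟩

theorem IsUnitaryHom.cpStarCondition {e : A.carrier ⟶ B.carrier} (he : IsUnitaryHom A B e)
    (hB : B.IsNormalisableDaggerFrobenius) : CPStarCondition A B e := by
  rw [cpStarCondition_iff hB, he.choi_eq]
  exact IsPositive.conjugate ⟨_, B.mul, choi_id hB.isDaggerFrobenius⟩ _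

theorem cpStarCondition_comp (hB : B.IsNormalisableDaggerFrobenius)
    (hC : C.IsNormalisableDaggerFrobenius) {f : A.carrier ⟶ B.carrier}
    {g : B.carrier ⟶ C.carrier} (hf : CPStarCondition A B f) (hg : CPStarCondition B C g) :
    CPStarCondition A C (f ≫ g) := by
  rw [cpStarCondition_iff hB] at hf
  rw [cpStarCondition_iff hC] at hg ⊢
  rw [choi_comp hB]
  exact (hf.tensor hg).conjugate _

theorem cpStarCondition_tensor (hB : B.IsNormalisableDaggerFrobenius)
    (hB' : B'.IsNormalisableDaggerFrobenius) {f : A.carrier ⟶ B.carrier}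
    {f' : A'.carrier ⟶ B'.carrier} (hf : CPStarCondition A B f) (hf' : CPStarCondition A' B' f') :
    CPStarCondition (A.tensor A') (B.tensor B') (f ⊗ₘ f') := by
  rw [cpStarCondition_iff hB] at hf
  rw [cpStarCondition_iff hB'] at hf'
  exact (cpStarCondition_iff (hB.tensor hB') _).2
    ((congrArg IsPositive (choi_tensor A B A' B' f f')).mpr ((hf.tensor hf').conjugate _))

theorem cpStarCondition_dag (hA : A.IsNormalisableDaggerFrobenius)
    (hB : B.IsNormalisableDaggerFrobenius) {f : A.carrier ⟶ B.carrier}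
    (hf : CPStarCondition A B f) : CPStarCondition B A (dag f) := by
  rw [cpStarCondition_iff hB] at hf
  rw [cpStarCondition_iff hA]
  exact isPositive_choi_dag hA hB hf

theorem cpStarCondition_casimir (hA : A.IsNormalisableDaggerFrobenius) :
    CPStarCondition (unit V) (A.op.tensor A) A.casimir := by
  refine (cpStarCondition_iff (hA.op.tensor hA) _).2 ?_
  have h := choi_unit (A.op.tensor A) A.casimir
  exact (congrArg IsPositive (h.trans (congrArg _ (congrArg (· ≫ _)
    (casimir_tensor_mul A hA.isDaggerFrobenius))))).mpr
      (IsPositive.conjugate ⟨_, A.mul, rfl⟩ _)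

theorem cpStarCondition_cup (hA : A.IsNormalisableDaggerFrobenius) :
    CPStarCondition (unit V) (A.dual.tensor A) (cup A.carrier) := by
  rw [← hA.isDaggerFrobenius.casimir_toDual, ← tensorHom_id]
  exact cpStarCondition_comp (hA.op.tensor hA) (hA.dual.tensor hA) (cpStarCondition_casimir hA)
    (cpStarCondition_tensor hA.dual hA (hA.toDual_isUnitaryHom.cpStarCondition hA.dual)
      (cpStarCondition_id hA))

theorem isUnitaryHom_braiding (hA : A.IsNormalisableDaggerFrobenius)
    (hB : B.IsNormalisableDaggerFrobenius) :
    IsUnitaryHom (A.tensor B) (B.tensor A) (β_ A.carrier B.carrier).hom := by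
  let _ : MonObj A.carrier := ⟨A.one, A.mul, hA.one_mul, hA.mul_one, hA.mul_assoc⟩
  let _ : MonObj B.carrier := ⟨B.one, B.mul, hB.one_mul, hB.mul_one, hB.mul_assoc⟩
  refine ⟨by simp [tensor], by simp [tensor], ?_⟩
  exact MonObj.mul_braiding A.carrier B.carrier

theorem isUnitaryHom_associator (hA : A.IsNormalisableDaggerFrobenius)
    (hB : B.IsNormalisableDaggerFrobenius) (hC : C.IsNormalisableDaggerFrobenius) :
    IsUnitaryHom ((A.tensor B).tensor C) (A.tensor (B.tensor C))
      (α_ A.carrier B.carrier C.carrier).hom := by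
  let _ : MonObj A.carrier := ⟨A.one, A.mul, hA.one_mul, hA.mul_one, hA.mul_assoc⟩
  let _ : MonObj B.carrier := ⟨B.one, B.mul, hB.one_mul, hB.mul_one, hB.mul_assoc⟩
  let _ : MonObj C.carrier := ⟨C.one, C.mul, hC.one_mul, hC.mul_one, hC.mul_assoc⟩
  refine ⟨by simp [tensor], by simp [tensor], ?_⟩
  exact MonObj.mul_associator (M := A.carrier) (N := B.carrier) (P := C.carrier)

theorem isUnitaryHom_leftUnitor (hA : A.IsNormalisableDaggerFrobenius) :
    IsUnitaryHom ((unit V).tensor A) A (λ_ A.carrier).hom := by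
  let _ : MonObj A.carrier := ⟨A.one, A.mul, hA.one_mul, hA.mul_one, hA.mul_assoc⟩
  refine ⟨by simp [tensor, unit], by simp [tensor, unit], ?_⟩
  have := MonObj.mul_leftUnitor (M := A.carrier)
  -- The monoid structure on the unit object multiplies by the left unitor, `AlgebraData.unit` by
  -- the right one.
  rw [unitors_equal] at this
  exact this

theorem isUnitaryHom_rightUnitor (hA : A.IsNormalisableDaggerFrobenius) :
    IsUnitaryHom (A.tensor (unit V)) A (ρ_ A.carrier).hom := by
  let _ : MonObj A.carrier := ⟨A.one, A.mul, hA.one_mul, hA.mul_one, hA.mul_assoc⟩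
  refine ⟨by simp [tensor, unit], by simp [tensor, unit], ?_⟩
  have := MonObj.mul_rightUnitor (M := A.carrier)
  rw [unitors_equal] at this
  exact this

end CPStarCondition

end AlgebraData
end DaggerCompact

/-! ### Assembly of the dagger compact category. -/

namespace DaggerCompact
open DaggerCategory (dag)

variable {V : Type u} [Category.{v} V] [MonoidalCategory V] [SymmetricCategory V]
  [DaggerCompactCategory V]

theorem AlgebraData.cpStarCondition_cap {A : AlgebraData V}
    (hA : A.IsNormalisableDaggerFrobenius) :
    CPStarCondition (A.tensor A.dual) (unit V) (cap A.carrier) := by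
  have h := cpStarCondition_dag unit_isNormalisableDaggerFrobenius (hA.dual.tensor hA)
    (cpStarCondition_cup hA)
  rw [cap_eq, ← dag_cup]
  exact cpStarCondition_comp (hA.dual.tensor hA) unit_isNormalisableDaggerFrobenius
    ((isUnitaryHom_braiding hA hA.dual).cpStarCondition (hA.dual.tensor hA)) h

namespace CPStar

instance category : Category.{v} (CPStar V) where
  Hom A B := {f : A.carrier ⟶ B.carrier // CPStarCondition A.toAlgebraData B.toAlgebraData f}
  id A := ⟨𝟙 A.carrier, AlgebraData.cpStarCondition_id A.isNormalisableDaggerFrobenius⟩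
  comp {_ B C} f g := ⟨f.1 ≫ g.1, AlgebraData.cpStarCondition_comp B.isNormalisableDaggerFrobenius
    C.isNormalisableDaggerFrobenius f.2 g.2⟩
  id_comp f := Subtype.ext (Category.id_comp f.1)
  comp_id f := Subtype.ext (Category.comp_id f.1)
  assoc f g h := Subtype.ext (Category.assoc f.1 g.1 h.1)

/-- The underlying morphism in `V`. -/
def forget {A B : CPStar V} (f : A ⟶ B) : A.carrier ⟶ B.carrier := f.1

/-- The dagger of a morphism of `CP*[V]`. -/
def dagger {A B : CPStar V} (f : A ⟶ B) : B ⟶ A :=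
  ⟨dag f.1, AlgebraData.cpStarCondition_dag A.isNormalisableDaggerFrobenius
    B.isNormalisableDaggerFrobenius f.2⟩

/-- A unitary multiplicative map of algebras, as an isomorphism of `CP*[V]`. -/
def isoOfIsUnitaryHom {A B : CPStar V} {e : A.carrier ⟶ B.carrier}
    (he : AlgebraData.IsUnitaryHom A.toAlgebraData B.toAlgebraData e) : A ≅ B where
  hom := ⟨e, he.cpStarCondition B.isNormalisableDaggerFrobenius⟩
  -- Taking the dagger itself as inverse makes unitarity of the coherence isomorphisms hold by
  -- definition.
  inv := ⟨dag e, AlgebraData.cpStarCondition_dag A.isNormalisableDaggerFrobenius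
    B.isNormalisableDaggerFrobenius (he.cpStarCondition B.isNormalisableDaggerFrobenius)⟩
  hom_inv_id := Subtype.ext he.hom_dag
  inv_hom_id := Subtype.ext he.dag_hom

/-- The tensor product of two objects of `CP*[V]`. -/
def tensor (A B : CPStar V) : CPStar V :=
  ⟨A.toAlgebraData.tensor B.toAlgebraData,
    A.isNormalisableDaggerFrobenius.tensor B.isNormalisableDaggerFrobenius⟩

/-- The dual of an object of `CP*[V]`. -/
def dual (A : CPStar V) : CPStar V :=
  ⟨A.toAlgebraData.dual, A.isNormalisableDaggerFrobenius.dual⟩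

variable (V) in
/-- The monoidal unit of `CP*[V]`. -/
def unit : CPStar V := ⟨AlgebraData.unit V, AlgebraData.unit_isNormalisableDaggerFrobenius⟩

/-- The tensor product of two morphisms of `CP*[V]`. -/
def tensorMap {A B C D : CPStar V} (f : A ⟶ B) (g : C ⟶ D) : A.tensor C ⟶ B.tensor D :=
  ⟨f.1 ⊗ₘ g.1, AlgebraData.cpStarCondition_tensor B.isNormalisableDaggerFrobenius
    D.isNormalisableDaggerFrobenius f.2 g.2⟩

instance monoidalCategoryStruct : MonoidalCategoryStruct (CPStar V) where
  tensorObj := tensor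
  tensorHom := tensorMap
  whiskerLeft A _ _ f := tensorMap (𝟙 A) f
  whiskerRight f A := tensorMap f (𝟙 A)
  tensorUnit := unit V
  associator A B C := isoOfIsUnitaryHom (A := (A.tensor B).tensor C) (B := A.tensor (B.tensor C))
    (AlgebraData.isUnitaryHom_associator A.isNormalisableDaggerFrobenius
      B.isNormalisableDaggerFrobenius C.isNormalisableDaggerFrobenius)
  leftUnitor A := isoOfIsUnitaryHom (A := (unit V).tensor A)
    (AlgebraData.isUnitaryHom_leftUnitor A.isNormalisableDaggerFrobenius)
  rightUnitor A := isoOfIsUnitaryHom (A := A.tensor (unit V))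
    (AlgebraData.isUnitaryHom_rightUnitor A.isNormalisableDaggerFrobenius)

instance monoidalCategory : MonoidalCategory (CPStar V) where
  tensorHom_def f g := Subtype.ext (by
    change f.1 ⊗ₘ g.1 = (f.1 ⊗ₘ 𝟙 _) ≫ (𝟙 _ ⊗ₘ g.1)
    rw [tensorHom_id, id_tensorHom, MonoidalCategory.tensorHom_def])
  id_tensorHom_id A B := Subtype.ext (id_tensorHom_id A.carrier B.carrier)
  tensorHom_comp_tensorHom f g h k := Subtype.ext (tensorHom_comp_tensorHom f.1 g.1 h.1 k.1)
  whiskerLeft_id A B := Subtype.ext (id_tensorHom_id A.carrier B.carrier)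
  id_whiskerRight A B := Subtype.ext (id_tensorHom_id A.carrier B.carrier)
  associator_naturality f g h := Subtype.ext (associator_naturality f.1 g.1 h.1)
  leftUnitor_naturality {A B} f := Subtype.ext (by
    change (𝟙 (𝟙_ V) ⊗ₘ f.1) ≫ (λ_ B.carrier).hom = (λ_ A.carrier).hom ≫ f.1; simp)
  rightUnitor_naturality {A B} f := Subtype.ext (by
    change (f.1 ⊗ₘ 𝟙 (𝟙_ V)) ≫ (ρ_ B.carrier).hom = (ρ_ A.carrier).hom ≫ f.1; simp)
  pentagon A B C D := Subtype.ext (by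
    change ((α_ A.carrier B.carrier C.carrier).hom ⊗ₘ 𝟙 D.carrier) ≫
      (α_ A.carrier (B.carrier ⊗ C.carrier) D.carrier).hom ≫
      (𝟙 A.carrier ⊗ₘ (α_ B.carrier C.carrier D.carrier).hom) =
      (α_ (A.carrier ⊗ B.carrier) C.carrier D.carrier).hom ≫
        (α_ A.carrier B.carrier (C.carrier ⊗ D.carrier)).hom
    simp)
  triangle A B := Subtype.ext (by
    change (α_ A.carrier (𝟙_ V) B.carrier).hom ≫ (𝟙 A.carrier ⊗ₘ (λ_ B.carrier).hom) =
      (ρ_ A.carrier).hom ⊗ₘ 𝟙 B.carrier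
    simp)

instance symmetricCategory : SymmetricCategory (CPStar V) where
  braiding A B := isoOfIsUnitaryHom (A := A.tensor B) (B := B.tensor A)
    (AlgebraData.isUnitaryHom_braiding A.isNormalisableDaggerFrobenius
      B.isNormalisableDaggerFrobenius)
  braiding_naturality_right A {B C} f := Subtype.ext (by
    change (𝟙 A.carrier ⊗ₘ f.1) ≫ (β_ A.carrier C.carrier).hom =
      (β_ A.carrier B.carrier).hom ≫ (f.1 ⊗ₘ 𝟙 A.carrier)
    simp)
  braiding_naturality_left {A B} f C := Subtype.ext (by
    change (f.1 ⊗ₘ 𝟙 C.carrier) ≫ (β_ B.carrier C.carrier).hom =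
      (β_ A.carrier C.carrier).hom ≫ (𝟙 C.carrier ⊗ₘ f.1)
    simp)
  hexagon_forward A B C := Subtype.ext (by
    change (α_ A.carrier B.carrier C.carrier).hom ≫ (β_ A.carrier (B.carrier ⊗ C.carrier)).hom ≫
      (α_ B.carrier C.carrier A.carrier).hom =
      ((β_ A.carrier B.carrier).hom ⊗ₘ 𝟙 C.carrier) ≫ (α_ B.carrier A.carrier C.carrier).hom ≫
        (𝟙 B.carrier ⊗ₘ (β_ A.carrier C.carrier).hom)
    simp)
  hexagon_reverse A B C := Subtype.ext (by
    change dag (α_ A.carrier B.carrier C.carrier).hom ≫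
      (β_ (A.carrier ⊗ B.carrier) C.carrier).hom ≫ dag (α_ C.carrier A.carrier B.carrier).hom =
      (𝟙 A.carrier ⊗ₘ (β_ B.carrier C.carrier).hom) ≫
        dag (α_ A.carrier C.carrier B.carrier).hom ≫
        ((β_ A.carrier C.carrier).hom ⊗ₘ 𝟙 B.carrier)
    simp)
  symmetry A B := Subtype.ext (SymmetricCategory.symmetry A.carrier B.carrier)

/-- The duality between an object of `CP*[V]` and its dual. -/
@[reducible]
def exactPairing (A : CPStar V) : ExactPairing A.dual A where
  coevaluation' := ⟨cup A.carrier,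
    AlgebraData.cpStarCondition_cup A.isNormalisableDaggerFrobenius⟩
  evaluation' := ⟨cap A.carrier,
    AlgebraData.cpStarCondition_cap A.isNormalisableDaggerFrobenius⟩
  coevaluation_evaluation' := Subtype.ext (by
    change (𝟙 A.carrier ⊗ₘ cup A.carrier) ≫
      dag (α_ A.carrier (dualObj A.carrier) A.carrier).hom ≫ (cap A.carrier ⊗ₘ 𝟙 A.carrier) =
      (ρ_ A.carrier).hom ≫ dag (λ_ A.carrier).hom
    simp)
  evaluation_coevaluation' := Subtype.ext (by
    change (cup A.carrier ⊗ₘ 𝟙 (dualObj A.carrier)) ≫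
      (α_ (dualObj A.carrier) A.carrier (dualObj A.carrier)).hom ≫
      (𝟙 (dualObj A.carrier) ⊗ₘ cap A.carrier) =
      (λ_ (dualObj A.carrier)).hom ≫ dag (ρ_ (dualObj A.carrier)).hom
    simp)

instance daggerCompactCategory : DaggerCompactCategory (CPStar V) where
  dag := dagger
  dag_id A := Subtype.ext (DaggerCategory.dag_id A.carrier)
  dag_comp f g := Subtype.ext (DaggerCategory.dag_comp f.1 g.1)
  dag_dag f := Subtype.ext (DaggerCategory.dag_dag f.1)
  leftDual A := @HasLeftDual.mk _ _ _ A A.dual (exactPairing A)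
  dag_tensorHom f g := Subtype.ext (DaggerCompactCategory.dag_tensorHom f.1 g.1)
  dag_associator _ _ _ := rfl
  dag_leftUnitor _ := rfl
  dag_rightUnitor _ := rfl
  dag_braiding _ _ := rfl
  dag_cap A := Subtype.ext (DaggerCompactCategory.dag_cap A.carrier)

theorem isCPStarStructure : IsCPStarStructure (V := V) forget where
  injective _ _ _ _ h := Subtype.ext h
  range _ _ f := ⟨fun ⟨φ, h⟩ => h ▸ φ.2, fun h => ⟨⟨f, h⟩, rfl⟩⟩
  map_id _ := rfl
  map_comp _ _ _ _ _ := rfl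
  map_dag _ _ _ := rfl
  tensorObj_eq _ _ := rfl
  tensorUnit_eq := rfl
  dualObj_eq _ := rfl
  map_tensorHom _ _ _ _ _ _ := HEq.rfl
  map_associator _ _ _ := HEq.rfl
  map_leftUnitor _ := HEq.rfl
  map_rightUnitor _ := HEq.rfl
  map_braiding _ _ := HEq.rfl
  map_cup _ := HEq.rfl
  map_cap _ := HEq.rfl

end CPStar
end DaggerCompact

open DaggerCompact in
theorem theorem3 (V : Type u) [Category.{v} V] [MonoidalCategory V] [SymmetricCategory V]
    [DaggerCompactCategory V] :
    ∃ (_ : Category.{v} (CPStar V)) (_ : MonoidalCategory (CPStar V))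
      (_ : SymmetricCategory (CPStar V)) (_ : DaggerCompactCategory (CPStar V))
      (U : ∀ {A B : CPStar V}, (A ⟶ B) → (A.carrier ⟶ B.carrier)),
      IsCPStarStructure U :=
  ⟨CPStar.category, CPStar.monoidalCategory, CPStar.symmetricCategory,
    CPStar.daggerCompactCategory, CPStar.forget, CPStar.isCPStarStructure⟩
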